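/- Let $(X,d)$ be a complete metric space, $\lambda\le 0$, and let $\phi:X\to(-\infty,\infty]$ be lower semi-continuous. Write $D(\phi)=\{\phi<\infty\}$ and fix $x_0\in D(\phi)$. A minimal geodesic is a map $\gamma:[0,1]\to X$ with $d(\gamma(s),\gamma(t))=|s-t|\,d(\gamma(0),\gamma(1))$ for all $s,t$. For $\tau>0$ put $\phi_\tau(x)=\inf_{z\in X}\{\phi(z)+d^2(x,z)/(2\tau)\}$ and let $J_\tau(x)$ be the set of points $z$ attaining this infimum. Assume: * ($\lambda$-convexity) any $x,y\in D(\phi)$ are joined by a minimal geodesic $\gamma$ with $\phi(\gamma(t))\le(1-t)\phi(x)+t\phi(y)-\frac{\lambda}{2}(1-t)t\,d^2(x,y)$ for all $t\in[0,1]$; * (coercivity) for some $\tau_*\in(0,\infty]$, one has $\phi_\tau(x)>-\infty$ and $J_\tau(x)\ne\emptyset$ for all $x\in X$ and $0<\tau<\tau_*$. Let $K\in\mathbb{R}$ and assume that one of the following holds: * (I) $X$ is a $\mathrm{CAT}(1)$-space with $\operatorname{diam}X<\pi/2$ (in this case $K$ is arbitrary; in particular the estimate below holds with $K'=0$); * (II)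 there is a family of minimal geodesics, joining any two points of $D(\phi)$, such that $\phi$ satisfies the $\lambda$-convexity inequality along each of its members with end points in $D(\phi)$; $d^2(z,\gamma(t))\le(1-t)d^2(z,\gamma(0))+t\,d^2(z,\gamma(1))-\frac K2(1-t)t\,d^2(\gamma(0),\gamma(1))$ for every member $\gamma$, $z\in X$ and $t\in[0,1]$; and, for any members $\gamma,\eta$ with $\gamma(0)=\eta(0)=x$, $\gamma(1)=y$ and $\eta(1)=z$, the limits $\lim_{s\downarrow0}\frac{d^2(\gamma(s),z)-d^2(x,z)}{s}$ and $\lim_{t\downarrow0}\frac{d^2(\eta(t),y)-d^2(x,y)}{t}$ exist and coincide. For a partition $\boldsymbol\tau:\ 0=t^0<t^1<\cdots\to\infty$ put $\tau_k=t^k-t^{k-1}$ and $|\boldsymbol\tau|=\sup_k\tau_k$. A discrete solution from $x_0$ associated with $\boldsymbol\tau$ is a sequence with $x^0=x_0$ and $x^k\in J_{\tau_k}(x^{k-1})$ for $k\ge1$. Its interpolations are $\bar x_{\boldsymbol\tau}(0)=x_0$ and, for $t\in(t^{k-1},t^k]$, $$\bar x_{\boldsymbol\tau}(t)=x^k,\qquad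 \bar d_{\boldsymbol\tau}(t;y)=\Big\{d^2(x^{k-1},y)+\tfrac{t-t^{k-1}}{\tau_k}\big(d^2(x^k,y)-d^2(x^{k-1},y)\big)\Big\}^{1/2}.$$ A gradient curve from $x_0$ is a curve $\xi:[0,\infty)\to X$ that is the pointwise limit of interpolated curves $\bar x_{\boldsymbol\tau_i}$ of discrete solutions from $x_0$, for some sequence of partitions with $|\boldsymbol\tau_i|\to0$. Then there is exactly one gradient curve $\xi$ from $x_0$, written $\xi(t)=\mathcal G(t,x_0)$. For every partition $\boldsymbol\tau$ with $|\boldsymbol\tau|<\tau_*$, every associated discrete solution from $x_0$ and every $t>0$, $$\bar d_{\boldsymbol\tau}^{\,2}(t;\xi(t))\le e^{-2\lambda t}\left(\sqrt{1-K'-\tfrac{2\lambda}{3}|\boldsymbol\tau|}+\sqrt{-\tfrac{4\lambda}{3}|\boldsymbol\tau|}\right)^{2}|\boldsymbol\tau|\,\big\{\phi(x_0)-\phi(\bar x_{\boldsymbol\tau}(t))\big\},\qquad K'=\min\{0,K\}.$$ In particular, for every $T>0$ there are $C\in\mathbb R$ and $\delta>0$ such that $\bar d_{\boldsymbol\tau}(t;\xi(t))\le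 C\sqrt{|\boldsymbol\tau|}$ for all $t\in(0,T]$, all partitions with $|\boldsymbol\tau|<\delta$ and all associated discrete solutions from $x_0$. -/

import Mathlib

open Set Filter Topology
open scoped ENNReal

noncomputable section

namespace MetricGF

/-! ### Geodesics, `CAT(1)` spaces -/

/-- `γ : [0,1] → X` (a function on `ℝ` of which only the values on `[0,1]` matter) is a minimal
geodesic from `x` to `y`. -/
def IsMinGeodesic {X : Type*} [MetricSpace X] (γ : ℝ → X) (x y : X) : Prop :=
  γ 0 = x ∧ γ 1 = y ∧
    ∀ s ∈ Icc (0 : ℝ) 1, ∀ t ∈ Icc (0 : ℝ) 1, dist (γ s) (γ t) = |s - t| * dist x y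

/-- The unit sphere `𝕊²` in Euclidean 3-space. -/
abbrev Sphere2 : Type := Metric.sphere (0 : EuclideanSpace ℝ (Fin 3)) 1

/-- The angular (great circle) distance on `𝕊²`. -/
def sphereDist (p q : Sphere2) : ℝ :=
  InnerProductGeometry.angle (p : EuclideanSpace ℝ (Fin 3)) (q : EuclideanSpace ℝ (Fin 3))

/-- `CAT(1)` spaces: geodesic spaces all of whose triangles `xyz` of perimeter `< 2π` are not
thicker than their comparison triangles `x'y'z'` in `𝕊²`.  The point `p` at distance `t d(y,z)`
from `y'` and `(1-t) d(y,z)` from `z'` is the point at time `t` of the (unique, as `d(y,z) < π`)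
minimal geodesic of `𝕊²` from `y'` to `z'`. -/
def IsCAT1 (X : Type*) [MetricSpace X] : Prop :=
  (∀ x y : X, ∃ γ : ℝ → X, IsMinGeodesic γ x y) ∧
  ∀ x y z : X, dist x y + dist y z + dist z x < 2 * Real.pi →
    ∀ γ : ℝ → X, IsMinGeodesic γ y z →
    ∀ x' y' z' : Sphere2, sphereDist x' y' = dist x y → sphereDist y' z' = dist y z →
      sphereDist z' x' = dist z x →
    ∀ t ∈ Icc (0 : ℝ) 1, ∀ p : Sphere2,
      sphereDist y' p = t * dist y z → sphereDist p z' = (1 - t) * dist y z →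
      dist x (γ t) ≤ sphereDist x' p

/-! ### Functions `φ : X → (-∞, ∞]`, convexity, the Moreau–Yosida approximation -/

/-- The `l`-convexity inequality of `φ` along `γ : [0,1] → X`; it is used only when `φ` is finite
at the end points. -/
def ConvexAlong {X : Type*} [MetricSpace X] (φ : X → EReal) (l : ℝ) (γ : ℝ → X) : Prop :=
  ∀ t ∈ Icc (0 : ℝ) 1,
    φ (γ t) ≤ (((1 - t) * (φ (γ 0)).toReal + t * (φ (γ 1)).toReal
      - l / 2 * (1 - t) * t * dist (γ 0) (γ 1) ^ 2 : ℝ) : EReal)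

/-- `φ` is `l`-convex: any two points of its domain are joined by some minimal geodesic along
which the `l`-convexity inequality holds. -/
def IsSemiConvex {X : Type*} [MetricSpace X] (φ : X → EReal) (l : ℝ) : Prop :=
  ∀ x y : X, φ x ≠ ⊤ → φ y ≠ ⊤ → ∃ γ : ℝ → X, IsMinGeodesic γ x y ∧ ConvexAlong φ l γ

/-- The squared distance from any point is `K`-convex along `γ`. -/
def SqDistConvexAlong {X : Type*} [MetricSpace X] (K : ℝ) (γ : ℝ → X) : Prop :=
  ∀ z : X, ∀ t ∈ Icc (0 : ℝ) 1,
    dist z (γ t) ^ 2 ≤ (1 - t) * dist z (γ 0) ^ 2 + t * dist z (γ 1) ^ 2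
      - K / 2 * (1 - t) * t * dist (γ 0) (γ 1) ^ 2

/-- Commutativity for two geodesics `γ`, `η` issuing from the same point: the one-sided
derivatives at `0` of `d²(γ(s), η(1))` and `d²(η(t), γ(1))` exist and agree. -/
def CommuteAtStart {X : Type*} [MetricSpace X] (γ η : ℝ → X) : Prop :=
  ∃ L : ℝ,
    Tendsto (fun s : ℝ => (dist (γ s) (η 1) ^ 2 - dist (γ 0) (η 1) ^ 2) / s) (𝓝[>] 0) (𝓝 L) ∧
    Tendsto (fun t : ℝ => (dist (η t) (γ 1) ^ 2 - dist (η 0) (γ 1) ^ 2) / t) (𝓝[>] 0) (𝓝 L)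

/-- There is a family `Γ` of minimal geodesics, joining any two points of the domain of `φ`, along
which the commutativity, the `K`-convexity of the squared distance function and the `l`-convexity
of `φ` hold. -/
def HasCommutingGeodesics {X : Type*} [MetricSpace X] (φ : X → EReal) (l K : ℝ) : Prop :=
  ∃ Γ : Set (ℝ → X),
    (∀ γ ∈ Γ, IsMinGeodesic γ (γ 0) (γ 1)) ∧
    (∀ x y : X, φ x ≠ ⊤ → φ y ≠ ⊤ → ∃ γ ∈ Γ, γ 0 = x ∧ γ 1 = y) ∧
    (∀ γ ∈ Γ, ∀ η ∈ Γ, γ 0 = η 0 → CommuteAtStart γ η) ∧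
    (∀ γ ∈ Γ, SqDistConvexAlong K γ) ∧
    (∀ γ ∈ Γ, φ (γ 0) ≠ ⊤ → φ (γ 1) ≠ ⊤ → ConvexAlong φ l γ)

/-- The Moreau–Yosida approximation `φ_τ(x)`. -/
def moreauYosida {X : Type*} [MetricSpace X] (φ : X → EReal) (τ : ℝ) (x : X) : EReal :=
  ⨅ z : X, φ z + ((dist x z ^ 2 / (2 * τ) : ℝ) : EReal)

/-- The set `J_τ^φ(x)` of points attaining the infimum in `φ_τ(x)`. -/
def resolvent {X : Type*} [MetricSpace X] (φ : X → EReal) (τ : ℝ) (x : X) : Set X :=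
  {z | φ z + ((dist x z ^ 2 / (2 * τ) : ℝ) : EReal) = moreauYosida φ τ x}

/-- Coercivity of `φ` with threshold `τs = τ_*(φ) ∈ (0,∞]`. -/
def Coercive {X : Type*} [MetricSpace X] (φ : X → EReal) (τs : ℝ≥0∞) : Prop :=
  0 < τs ∧ ∀ (x : X) (τ : ℝ), 0 < τ → ENNReal.ofReal τ < τs →
    moreauYosida φ τ x ≠ ⊥ ∧ (resolvent φ τ x).Nonempty

/-! ### Discrete solutions and their interpolations -/

/-- A partition `0 = t⁰ < t¹ < ⋯ → ∞` of `[0,∞)`. -/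
structure TimePartition where
  pt : ℕ → ℝ
  pt_zero : pt 0 = 0
  strictMono : StrictMono pt
  tendsto_atTop : Tendsto pt atTop atTop

/-- The mesh `|τ| = sup_k (t^k - t^{k-1}) ∈ [0,∞]`. -/
def TimePartition.mesh (P : TimePartition) : ℝ≥0∞ :=
  ⨆ k : ℕ, ENNReal.ofReal (P.pt (k + 1) - P.pt k)

/-- The least `k` with `t ≤ t^k`. -/
def TimePartition.index (P : TimePartition) (t : ℝ) : ℕ := sInf {k : ℕ | t ≤ P.pt k}

theorem TimePartition.index_of_mem_Ioc (P : TimePartition) {t : ℝ} {k : ℕ}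
    (ht : t ∈ Ioc (P.pt k) (P.pt (k + 1))) : P.index t = k + 1 := by
  apply le_antisymm
  · exact Nat.sInf_le ht.2
  · have hne : {k : ℕ | t ≤ P.pt k}.Nonempty := ⟨k + 1, ht.2⟩
    have hm : t ≤ P.pt (P.index t) := Nat.sInf_mem hne
    exact Nat.succ_le_of_lt (P.strictMono.lt_iff_lt.1 (lt_of_lt_of_le ht.1 hm))

theorem TimePartition.index_zero (P : TimePartition) : P.index 0 = 0 :=
  Nat.le_zero.1 (Nat.sInf_le P.pt_zero.ge)

/-- `x` is a discrete solution from `x₀` associated with the partition `P`. -/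
def IsDiscreteSolution {X : Type*} [MetricSpace X] (φ : X → EReal) (P : TimePartition) (x₀ : X)
    (x : ℕ → X) : Prop :=
  x 0 = x₀ ∧ ∀ k : ℕ, x (k + 1) ∈ resolvent φ (P.pt (k + 1) - P.pt k) (x k)

/-- The interpolated curve: `x^k` for `t ∈ (t^{k-1}, t^k]`, and `x⁰` at `t = 0`. -/
def interp {X : Type*} (P : TimePartition) (x : ℕ → X) (t : ℝ) : X := x (P.index t)

/-- The interpolation of the distances `d(x^k, y)`: for `t ∈ (t^{k-1}, t^k]`, the square root of
`d²(x^{k-1},y) + (t - t^{k-1}) / (t^k - t^{k-1}) * (d²(x^k,y) - d²(x^{k-1},y))`. -/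
def interpDist {X : Type*} [MetricSpace X] (P : TimePartition) (x : ℕ → X) (t : ℝ) (y : X) : ℝ :=
  Real.sqrt (dist (x (P.index t - 1)) y ^ 2 +
    (t - P.pt (P.index t - 1)) / (P.pt (P.index t) - P.pt (P.index t - 1)) *
      (dist (x (P.index t)) y ^ 2 - dist (x (P.index t - 1)) y ^ 2))

theorem interp_zero {X : Type*} (P : TimePartition) (x : ℕ → X) : interp P x 0 = x 0 := by
  rw [interp, P.index_zero]

theorem interp_of_mem_Ioc {X : Type*} (P : TimePartition) (x : ℕ → X) {t : ℝ} {k : ℕ}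
    (ht : t ∈ Ioc (P.pt k) (P.pt (k + 1))) : interp P x t = x (k + 1) := by
  rw [interp, P.index_of_mem_Ioc ht]

theorem interpDist_of_mem_Ioc {X : Type*} [MetricSpace X] (P : TimePartition) (x : ℕ → X) {t : ℝ}
    {k : ℕ} (ht : t ∈ Ioc (P.pt k) (P.pt (k + 1))) (y : X) :
    interpDist P x t y = Real.sqrt (dist (x k) y ^ 2 +
      (t - P.pt k) / (P.pt (k + 1) - P.pt k) * (dist (x (k + 1)) y ^ 2 - dist (x k) y ^ 2)) := by
  simp only [interpDist, P.index_of_mem_Ioc ht, Nat.add_sub_cancel]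

/-! ### Gradient curves and the gradient flow -/

/-- `ξ : [0,∞) → X` (a function on `ℝ` of which only the values on `[0,∞)` matter) is a gradient
curve from `x₀`: the pointwise limit of interpolated discrete solutions from `x₀` associated with
some sequence of partitions whose meshes tend to `0`. -/
def IsGradientCurve {X : Type*} [MetricSpace X] (φ : X → EReal) (x₀ : X) (ξ : ℝ → X) : Prop :=
  ∃ (P : ℕ → TimePartition) (x : ℕ → ℕ → X),
    (∀ i, IsDiscreteSolution φ (P i) x₀ (x i)) ∧
    Tendsto (fun i => (P i).mesh) atTop (𝓝 0) ∧
    ∀ t : ℝ, 0 ≤ t → Tendsto (fun i => interp (P i) (x i) t) atTop (𝓝 (ξ t))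

open Classical in
/-- The gradient flow `𝒢(t, x₀) = ξ(t)`, with `ξ` the gradient curve from `x₀` (and the constant
curve if there is none). -/
def gradientFlow {X : Type*} [MetricSpace X] (φ : X → EReal) (t : ℝ) (x₀ : X) : X :=
  if h : ∃ ξ : ℝ → X, IsGradientCurve φ x₀ ξ then h.choose t else x₀

end MetricGF

end

/-!
Both hypotheses (I) and (II) enter through one inequality only, the discrete evolution variational
inequality for a step `z ∈ J_τ(x)`:
`d²(z, y) ≤ d²(x, y) + κ/2 d²(x, z) + 2 τ (φ(y) - φ(z)) + μ τ d²(z, y)`, `μ = -λ`, `κ = -K'`.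
It is the first order condition for the minimality of `z` along the geodesic from `z` to `y`, the
slope of `d²(x, ·)` being bounded by commutativity and `K`-convexity in case (II), and by comparison
with a spherical triangle in case (I).

Given two discrete solutions, interpolate `d²(x^k, y^j)` affinely along both partitions. Adding the
variational inequalities of `x` at `y` and of `y` at `x`, the energies cancel up to the energy
dissipated within the current cells, and a Grönwall argument bounds the interpolated distance by
`exp (μ t)` times a sum of two error terms of order `√(|τ| (φ(x₀) - φ(x(t))))`, one for each
solution. Since coercivity bounds the energy drop uniformly for small meshes, discrete solutions
form a Cauchy family as the meshes vanish. This gives existence and uniqueness of the limit, and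
letting only one of the two meshes tend to `0` gives the error estimate.
-/

noncomputable section

namespace MetricGF

/-! ### Interpolation along a partition -/

namespace TimePartition

variable (P : TimePartition)

theorem pt_nonneg (k : ℕ) : 0 ≤ P.pt k :=
  P.pt_zero.ge.trans (P.strictMono.monotone k.zero_le)

theorem step_pos (k : ℕ) : 0 < P.pt (k + 1) - P.pt k :=
  sub_pos.2 (P.strictMono k.lt_succ_self)

theorem ofReal_step_le_mesh (k : ℕ) : ENNReal.ofReal (P.pt (k + 1) - P.pt k) ≤ P.mesh :=
  le_iSup (fun k : ℕ => ENNReal.ofReal (P.pt (k + 1) - P.pt k)) k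

theorem step_le_mesh (h : P.mesh ≠ ⊤) (k : ℕ) : P.pt (k + 1) - P.pt k ≤ P.mesh.toReal :=
  (ENNReal.ofReal_le_iff_le_toReal h).1 (P.ofReal_step_le_mesh k)

theorem exists_mem_Ioc {t : ℝ} (ht : 0 < t) : ∃ k, t ∈ Ioc (P.pt k) (P.pt (k + 1)) := by
  have h := iUnion_Ioc_map_succ_eq_Ioi (fun k => P.strictMono.monotone (bot_le (a := k)))
    (not_bddAbove_of_tendsto_atTop P.tendsto_atTop)
  rw [bot_eq_zero, P.pt_zero] at h
  exact mem_iUnion.1 (h.ge ht)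

theorem exists_mem_Ico {t : ℝ} (ht : 0 ≤ t) : ∃ k, t ∈ Ico (P.pt k) (P.pt (k + 1)) := by
  have h := iUnion_Ico_map_succ_eq_Ici (fun k => P.strictMono.monotone (bot_le (a := k)))
    (not_bddAbove_of_tendsto_atTop P.tendsto_atTop)
  rw [bot_eq_zero, P.pt_zero] at h
  exact mem_iUnion.1 (h.ge ht)

theorem le_pt_index (t : ℝ) : t ≤ P.pt (P.index t) :=
  Nat.sInf_mem (s := {k | t ≤ P.pt k}) (P.tendsto_atTop.eventually_ge_atTop t).exists

theorem index_mono : Monotone P.index := fun _ t hst =>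
  Nat.sInf_le (hst.trans (P.le_pt_index t))

theorem pt_index_pred_le {t : ℝ} (ht : 0 ≤ t) : P.pt (P.index t - 1) ≤ t := by
  rcases ht.eq_or_lt with rfl | ht
  · rw [P.index_zero, P.pt_zero]
  · obtain ⟨k, hk⟩ := P.exists_mem_Ioc ht
    rw [P.index_of_mem_Ioc hk]
    exact hk.1.le

theorem continuousOn_Ici_of_cells {f : ℝ → ℝ}
    (hf : ∀ k, ContinuousOn f (Icc (P.pt k) (P.pt (k + 1)))) : ContinuousOn f (Ici 0) := by
  have hfin : LocallyFinite fun k => Icc (P.pt k) (P.pt (k + 1)) := fun t => by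
    obtain ⟨N, hN⟩ := (P.tendsto_atTop.eventually_gt_atTop t).exists
    refine ⟨Iio (P.pt N), Iio_mem_nhds hN, (finite_lt_nat N).subset ?_⟩
    rintro k ⟨s, hs, hsN⟩
    exact P.strictMono.lt_iff_lt.1 (hs.1.trans_lt hsN)
  refine (hfin.continuousOn_iUnion (fun _ => isClosed_Icc) (fun k => hf k)).mono fun t ht => ?_
  obtain ⟨k, hk⟩ := P.exists_mem_Ico ht
  exact mem_iUnion.2 ⟨k, Ico_subset_Icc_self hk⟩

/-- The affine parameter of `t` on the cell `[t^k, t^{k+1}]`. -/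
def weight (k : ℕ) (t : ℝ) : ℝ := (t - P.pt k) / (P.pt (k + 1) - P.pt k)

theorem weight_mem_Icc {k : ℕ} {t : ℝ} (ht : t ∈ Icc (P.pt k) (P.pt (k + 1))) :
    P.weight k t ∈ Icc (0 : ℝ) 1 :=
  ⟨div_nonneg (sub_nonneg.2 ht.1) (P.step_pos k).le,
    (div_le_one (P.step_pos k)).2 (sub_le_sub_right ht.2 _)⟩

theorem weight_pt (k : ℕ) : P.weight k (P.pt k) = 0 := by simp [weight]

theorem weight_pt_succ (k : ℕ) : P.weight k (P.pt (k + 1)) = 1 := div_self (P.step_pos k).ne'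

/-- The interpolation of a sequence `c` with respect to the partition which, on the cell
`(t^k, t^{k+1}]`, moves from `c k` to `c (k + 1)` with the profile `1 - (1 - w)^n`, where `w` is
the affine parameter of the cell; for `n = 1` it is piecewise affine. The profiles `n = 2, 3` are
the primitives of the weights `1 - w`, `(1 - w)²` in the error terms. -/
def interpolate (n : ℕ) (c : ℕ → ℝ) (t : ℝ) : ℝ :=
  c (P.index t - 1) +
    (1 - (1 - P.weight (P.index t - 1) t) ^ n) * (c (P.index t) - c (P.index t - 1))

theorem interpolate_of_mem_Icc {n : ℕ} (hn : n ≠ 0) (c : ℕ → ℝ) {k : ℕ} {t : ℝ}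
    (ht : t ∈ Icc (P.pt k) (P.pt (k + 1))) :
    P.interpolate n c t = c k + (1 - (1 - P.weight k t) ^ n) * (c (k + 1) - c k) := by
  rcases ht.1.eq_or_lt with rfl | h
  · rw [P.weight_pt, sub_zero, one_pow, sub_self, zero_mul, add_zero, interpolate]
    cases k with
    | zero => simp [P.pt_zero, P.index_zero]
    | succ k =>
      rw [P.index_of_mem_Ioc ⟨P.strictMono k.lt_succ_self, le_rfl⟩, Nat.add_sub_cancel,
        P.weight_pt_succ, sub_self, zero_pow hn]
      ring
  · rw [interpolate, P.index_of_mem_Ioc ⟨h, ht.2⟩, Nat.add_sub_cancel]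

theorem interpolate_one_of_mem_Icc (c : ℕ → ℝ) {k : ℕ} {t : ℝ}
    (ht : t ∈ Icc (P.pt k) (P.pt (k + 1))) :
    P.interpolate 1 c t = c k + P.weight k t * (c (k + 1) - c k) := by
  rw [P.interpolate_of_mem_Icc one_ne_zero c ht, pow_one, sub_sub_cancel]

theorem interpolate_zero_right (n : ℕ) (c : ℕ → ℝ) : P.interpolate n c 0 = c 0 := by
  simp [interpolate, P.index_zero]

theorem one_sub_pow_mem_Icc (n : ℕ) {t : ℝ} (ht : 0 ≤ t) :
    1 - (1 - P.weight (P.index t - 1) t) ^ n ∈ Icc (0 : ℝ) 1 := by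
  have hw : P.weight (P.index t - 1) t ∈ Icc (0 : ℝ) 1 :=
    P.weight_mem_Icc ⟨P.pt_index_pred_le ht,
      (P.le_pt_index t).trans (P.strictMono.monotone (by omega))⟩
  exact ⟨sub_nonneg.2 (pow_le_one₀ (sub_nonneg.2 hw.2) (sub_le_self 1 hw.1)),
    sub_le_self 1 (pow_nonneg (sub_nonneg.2 hw.2) n)⟩

theorem interpolate_mem_uIcc (n : ℕ) (c : ℕ → ℝ) {t : ℝ} (ht : 0 ≤ t) :
    P.interpolate n c t ∈ uIcc (c (P.index t - 1)) (c (P.index t)) := by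
  rw [← segment_eq_uIcc, segment_eq_image']
  exact ⟨_, P.one_sub_pow_mem_Icc n ht, rfl⟩

theorem interpolate_le_of_monotone (n : ℕ) {c : ℕ → ℝ} (hc : Monotone c) {t : ℝ} (ht : 0 ≤ t) :
    P.interpolate n c t ≤ c (P.index t) :=
  (P.interpolate_mem_uIcc n c ht).2.trans_eq (max_eq_right (hc (Nat.sub_le _ _)))

theorem continuousOn_interpolate {n : ℕ} (hn : n ≠ 0) {f : ℕ → ℝ → ℝ}
    (hf : ∀ k, ContinuousOn (f k) (Ici 0)) :
    ContinuousOn (fun t => P.interpolate n (fun k => f k t) t) (Ici 0) := by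
  refine P.continuousOn_Ici_of_cells fun k => ContinuousOn.congr ?_ fun t ht =>
    P.interpolate_of_mem_Icc hn _ ht
  have hfk : ∀ i, ContinuousOn (f i) (Icc (P.pt k) (P.pt (k + 1))) := fun i =>
    (hf i).mono (Icc_subset_Ici_self.trans (Ici_subset_Ici.2 (P.pt_nonneg k)))
  have hw : Continuous (P.weight k) := by unfold weight; fun_prop
  exact (hfk k).add ((by fun_prop : Continuous _).continuousOn.mul ((hfk (k + 1)).sub (hfk k)))

theorem hasDerivWithinAt_interpolate {n : ℕ} (hn : n ≠ 0) {f : ℕ → ℝ → ℝ} {f' : ℕ → ℝ} {k : ℕ}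
    {t : ℝ} (ht : t ∈ Ico (P.pt k) (P.pt (k + 1)))
    (hf : ∀ i, HasDerivWithinAt (f i) (f' i) (Ici t) t) :
    HasDerivWithinAt (fun s => P.interpolate n (fun i => f i s) s)
      (f' k + (1 - (1 - P.weight k t) ^ n) * (f' (k + 1) - f' k) +
        n * (1 - P.weight k t) ^ (n - 1) * ((f (k + 1) t - f k t) / (P.pt (k + 1) - P.pt k)))
      (Ici t) t := by
  have hw : HasDerivWithinAt (P.weight k) (1 / (P.pt (k + 1) - P.pt k)) (Ici t) t :=
    ((hasDerivWithinAt_id t _).sub_const _).div_const _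
  have hcell := (hf k).add ((((hw.const_sub 1).pow n).const_sub 1).mul ((hf (k + 1)).sub (hf k)))
  have hnhds : Icc (P.pt k) (P.pt (k + 1)) ∈ 𝓝[≥] t :=
    mem_of_superset (Ico_mem_nhdsGE ht.2)
      (Ico_subset_Icc_self.trans (Icc_subset_Icc_left ht.1))
  refine (hcell.congr_of_eventuallyEq_of_mem ?_ self_mem_Ici).congr_deriv ?_
  · filter_upwards [hnhds] with s hs using P.interpolate_of_mem_Icc hn _ hs
  · simp only [Pi.sub_apply, Pi.pow_apply]
    ring

theorem hasDerivWithinAt_interpolate_const {n : ℕ} (hn : n ≠ 0) (c : ℕ → ℝ) {k : ℕ} {t : ℝ}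
    (ht : t ∈ Ico (P.pt k) (P.pt (k + 1))) :
    HasDerivWithinAt (P.interpolate n c)
      (n * (1 - P.weight k t) ^ (n - 1) * ((c (k + 1) - c k) / (P.pt (k + 1) - P.pt k)))
      (Ici t) t := by
  simpa using P.hasDerivWithinAt_interpolate hn ht fun i => hasDerivWithinAt_const t (Ici t) (c i)

end TimePartition

/-! ### Scalar inequalities -/

/-- Gronwall's inequality for `U' ≤ A' + B' √U`. With `S` the maximum of `U`, the right hand side
is at most `A' + √S B'`, so that integration up to the maximum point yields `S ≤ a + √S b`. -/
theorem sqrt_le_of_deriv_right_le_add_mul_sqrt {U A B : ℝ → ℝ} {a b T : ℝ} (hT : 0 ≤ T)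
    (hUc : ContinuousOn U (Ici 0)) (hAc : ContinuousOn A (Ici 0)) (hBc : ContinuousOn B (Ici 0))
    (hU0 : U 0 = 0) (hA0 : A 0 = 0) (hB0 : B 0 = 0)
    (hA : ∀ t ∈ Icc 0 T, A t ≤ a) (hB : ∀ t ∈ Icc 0 T, B t ≤ b)
    (hderiv : ∀ t, 0 ≤ t → ∃ U' A' B', HasDerivWithinAt U U' (Ici t) t ∧
      HasDerivWithinAt A A' (Ici t) t ∧ HasDerivWithinAt B B' (Ici t) t ∧
      0 ≤ B' ∧ U' ≤ A' + B' * √(U t)) :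
    √(U T) ≤ √a + b := by
  choose! U' A' B' hU' hA' hB' hB'0 hle using hderiv
  obtain ⟨t₀, ht₀, hmax⟩ := isCompact_Icc.exists_isMaxOn (nonempty_Icc.2 hT)
    (hUc.mono Icc_subset_Ici_self)
  set S := U t₀
  have hS : S ≤ A t₀ + √S * B t₀ := by
    refine image_le_of_deriv_right_le_deriv_boundary (f := U) (f' := U') (a := 0) (b := t₀)
      (B := fun t => A t + √S * B t) (B' := fun t => A' t + √S * B' t)
      (hUc.mono Icc_subset_Ici_self) (fun t ht => hU' t ht.1) (by simp [hU0, hA0, hB0])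
      ((hAc.add (hBc.const_mul _)).mono Icc_subset_Ici_self)
      (fun t ht => (hA' t ht.1).add ((hB' t ht.1).const_mul _)) (fun t ht => ?_)
      (right_mem_Icc.2 ht₀.1)
    have hUS : U t ≤ S := hmax ⟨ht.1, ht.2.le.trans ht₀.2⟩
    rw [mul_comm √S]
    exact (hle t ht.1).trans (by gcongr; exact hB'0 t ht.1)
  have hUT : U T ≤ S := hmax (right_mem_Icc.2 hT)
  have hS0 : 0 ≤ S := hU0.ge.trans (hmax (left_mem_Icc.2 hT))
  have ha : 0 ≤ a := hA0.ge.trans (hA 0 (left_mem_Icc.2 hT))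
  have hb : 0 ≤ b := hB0.ge.trans (hB 0 (left_mem_Icc.2 hT))
  have hquad : √S * √S ≤ √a * √a + √S * b := by
    rw [Real.mul_self_sqrt hS0, Real.mul_self_sqrt ha]
    exact hS.trans (add_le_add (hA t₀ ht₀)
      (mul_le_mul_of_nonneg_left (hB t₀ ht₀) (Real.sqrt_nonneg S)))
  refine (Real.sqrt_le_sqrt hUT).trans (le_of_not_gt fun hlt => ?_)
  nlinarith [Real.sqrt_nonneg a, Real.sqrt_nonneg S]

theorem le_add_two_mul_sqrt {v c G : ℝ} (hG : 0 ≤ G) (h : ∀ s, 0 < s → v ≤ c + (s + G / s)) :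
    v ≤ c + 2 * √G := by
  rcases hG.eq_or_lt with rfl | hG
  · refine le_of_forall_pos_le_add fun ε hε => ?_
    simpa using h ε hε
  · have := h √G (Real.sqrt_pos.2 hG)
    rw [Real.div_sqrt] at this
    linarith

theorem two_mul_mul_le_add_div {s : ℝ} (hs : 0 < s) (x y : ℝ) :
    2 * x * y ≤ 2 * s * x ^ 2 + y ^ 2 / (2 * s) := by
  have h : 0 ≤ (2 * s * x - y) ^ 2 / (2 * s) := by positivity
  have e : (2 * s * x - y) ^ 2 / (2 * s) = 2 * s * x ^ 2 + y ^ 2 / (2 * s) - 2 * x * y := by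
    field_simp
    ring
  linarith

theorem sqrt_add_le_add_sqrt {a b : ℝ} (ha : 0 ≤ a) (hb : 0 ≤ b) : √(a + b) ≤ √a + √b :=
  Real.sqrt_le_iff.2 ⟨by positivity, by
    nlinarith [Real.sq_sqrt ha, Real.sq_sqrt hb,
      mul_nonneg (Real.sqrt_nonneg a) (Real.sqrt_nonneg b)]⟩

theorem sqrt_lerp_le {u v m : ℝ} (hu : 0 ≤ u) (hv : 0 ≤ v) (hm : m ∈ Icc (0 : ℝ) 1) :
    √u + m * (√v - √u) ≤ √(u + m * (v - u)) := by
  have h := Real.strictConcaveOn_sqrt.concaveOn.2 (mem_Ici.2 hu) (mem_Ici.2 hv)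
    (sub_nonneg.2 hm.2) hm.1 (sub_add_cancel 1 m)
  simp only [smul_eq_mul] at h
  calc √u + m * (√v - √u) = (1 - m) * √u + m * √v := by ring
    _ ≤ √((1 - m) * u + m * v) := h
    _ = √(u + m * (v - u)) := by ring_nf

/-- The discrete evolution variational inequality in terms of the interpolated squared distance
`v`: `a`, `b` are the distances of two consecutive points from a third one and `D` is the length
of the step. -/
theorem slope_le_of_evi {τ a b D κ μ p w φ₀ φ₁ ψ : ℝ} (hτ : 0 < τ) (hb : 0 ≤ b) (hκ : 0 ≤ κ)
    (hμ : 0 ≤ μ) (hab : b ≤ a + D)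
    (hevi : b ^ 2 ≤ a ^ 2 + κ / 2 * D ^ 2 + 2 * τ * (ψ - φ₁) + μ * τ * b ^ 2)
    (hD : D ^ 2 ≤ 2 * τ * (φ₀ - φ₁)) (hp : τ ≤ p) (hw : w ∈ Icc (0 : ℝ) 1) {v : ℝ}
    (hv : v = a ^ 2 + w * (b ^ 2 - a ^ 2)) :
    (b ^ 2 - a ^ 2) / τ ≤ 2 * (ψ - (φ₀ + w * (φ₁ - φ₀))) + μ * v + 2 * μ * ((1 - w) * D) * √v
      + (2 * (1 - w) + κ + 2 * μ * p * (1 - w) ^ 2) * (φ₀ - φ₁) := by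
  obtain ⟨hw0, hw1⟩ := hw
  have hΔ : 0 ≤ φ₀ - φ₁ := (mul_nonneg_iff_of_pos_left (by positivity)).1 ((sq_nonneg D).trans hD)
  have hv0 : 0 ≤ v := by nlinarith [sq_nonneg a, sq_nonneg b]
  have hvb : b ≤ √v + (1 - w) * D := by
    have hlerp : a + w * (b - a) ≤ √v := Real.le_sqrt_of_sq_le (by
      nlinarith [mul_nonneg (mul_nonneg hw0 (sub_nonneg.2 hw1)) (sq_nonneg (a - b))])
    nlinarith
  have hb2 : b ^ 2 ≤ v + 2 * ((1 - w) * D) * √v + (1 - w) ^ 2 * (2 * p * (φ₀ - φ₁)) :=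
    calc b ^ 2 ≤ (√v + (1 - w) * D) ^ 2 := pow_le_pow_left₀ hb hvb 2
      _ = v + 2 * ((1 - w) * D) * √v + (1 - w) ^ 2 * D ^ 2 := by
        rw [add_sq, Real.sq_sqrt hv0]
        ring
      _ ≤ _ := by
        gcongr
        exact hD.trans (by gcongr)
  have hslope : (b ^ 2 - a ^ 2) / τ ≤ 2 * (ψ - φ₁) + κ * (φ₀ - φ₁) + μ * b ^ 2 := by
    rw [div_le_iff₀ hτ]
    nlinarith
  linarith [mul_le_mul_of_nonneg_left hb2 hμ]

/-! ### Discrete solutions -/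

section DiscreteSolution

variable {X : Type*} [MetricSpace X] {φ : X → EReal}

theorem ne_top_of_mem_resolvent {τ : ℝ} {x z : X} (hx : φ x ≠ ⊤) (hz : z ∈ resolvent φ τ x) :
    φ z ≠ ⊤ := by
  have hle : φ z + ((dist x z ^ 2 / (2 * τ) : ℝ) : EReal) ≤
      φ x + ((dist x x ^ 2 / (2 * τ) : ℝ) : EReal) :=
    (show φ z + _ = moreauYosida φ τ x from hz).trans_le (iInf_le _ x)
  intro h
  rw [h, EReal.top_add_coe, top_le_iff, dist_self] at hle
  exact hx (by simpa using hle)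

theorem add_le_of_mem_resolvent (hbot : ∀ x, φ x ≠ ⊥) {τ : ℝ} {x z w : X} (hx : φ x ≠ ⊤)
    (hz : z ∈ resolvent φ τ x) {r : ℝ} (hw : φ w ≤ (r : EReal)) :
    (φ z).toReal + dist x z ^ 2 / (2 * τ) ≤ r + dist x w ^ 2 / (2 * τ) := by
  have hle : φ z + ((dist x z ^ 2 / (2 * τ) : ℝ) : EReal) ≤
      (r : EReal) + ((dist x w ^ 2 / (2 * τ) : ℝ) : EReal) :=
    (show φ z + _ = moreauYosida φ τ x from hz).trans_le
      ((iInf_le _ w).trans (add_le_add_left hw _))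
  rw [← EReal.coe_toReal (ne_top_of_mem_resolvent hx hz) (hbot z)] at hle
  exact_mod_cast hle

theorem sq_dist_le_of_mem_resolvent (hbot : ∀ x, φ x ≠ ⊥) {τ : ℝ} (hτ : 0 < τ) {x z : X}
    (hx : φ x ≠ ⊤) (hz : z ∈ resolvent φ τ x) :
    dist x z ^ 2 ≤ 2 * τ * ((φ x).toReal - (φ z).toReal) := by
  have h := add_le_of_mem_resolvent hbot hx hz (EReal.coe_toReal hx (hbot x)).ge
  rw [dist_self, zero_pow two_ne_zero, zero_div, add_zero, ← le_sub_iff_add_le',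
    div_le_iff₀ (by positivity)] at h
  linarith

/-- The discrete evolution variational inequality for one step `z ∈ J_τ(x)` of the minimizing
movement scheme, with `μ = -λ` and `κ = -K'` in the notation of the theorem. -/
def DiscreteEVI (φ : X → EReal) (μ κ : ℝ) : Prop :=
  ∀ (τ : ℝ) (x z y : X), 0 < τ → φ x ≠ ⊤ → φ y ≠ ⊤ → z ∈ resolvent φ τ x →
    dist z y ^ 2 ≤ dist x y ^ 2 + κ / 2 * dist x z ^ 2
      + 2 * τ * ((φ y).toReal - (φ z).toReal) + μ * τ * dist z y ^ 2

namespace IsDiscreteSolution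

variable {P : TimePartition} {x₀ : X} {x : ℕ → X}

theorem ne_top (hx : IsDiscreteSolution φ P x₀ x) (hx₀ : φ x₀ ≠ ⊤) (k : ℕ) : φ (x k) ≠ ⊤ := by
  induction k with
  | zero => rwa [hx.1]
  | succ k ih => exact ne_top_of_mem_resolvent ih (hx.2 k)

theorem sq_dist_le (hx : IsDiscreteSolution φ P x₀ x) (hbot : ∀ x, φ x ≠ ⊥) (hx₀ : φ x₀ ≠ ⊤)
    (k : ℕ) : dist (x k) (x (k + 1)) ^ 2 ≤
      2 * (P.pt (k + 1) - P.pt k) * ((φ (x k)).toReal - (φ (x (k + 1))).toReal) :=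
  sq_dist_le_of_mem_resolvent hbot (P.step_pos k) (hx.ne_top hx₀ k) (hx.2 k)

theorem antitone (hx : IsDiscreteSolution φ P x₀ x) (hbot : ∀ x, φ x ≠ ⊥) (hx₀ : φ x₀ ≠ ⊤) :
    Antitone fun k => (φ (x k)).toReal := by
  refine antitone_nat_of_succ_le fun k => sub_nonneg.1 ?_
  exact (mul_nonneg_iff_of_pos_left (mul_pos two_pos (P.step_pos k))).1
    ((sq_nonneg _).trans (hx.sq_dist_le hbot hx₀ k))

theorem energy_drop_nonneg (hx : IsDiscreteSolution φ P x₀ x) (hbot : ∀ x, φ x ≠ ⊥)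
    (hx₀ : φ x₀ ≠ ⊤) (t : ℝ) : 0 ≤ (φ x₀).toReal - (φ (interp P x t)).toReal := by
  have h := hx.antitone hbot hx₀ (Nat.zero_le (P.index t))
  simp only [hx.1] at h
  exact sub_nonneg.2 h

end IsDiscreteSolution

/-- The interpolated squared distance of two discrete solutions `x`, `y`: the squared distances
`d²(x^k, y^j)` are interpolated affinely in `k` along `P` and in `j` along `Q`. -/
def sqDistInterp (P Q : TimePartition) (x y : ℕ → X) (t : ℝ) : ℝ :=
  P.interpolate 1 (fun k => Q.interpolate 1 (fun j => dist (x k) (y j) ^ 2) t) t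

theorem continuousOn_sqDistInterp (P Q : TimePartition) (x y : ℕ → X) :
    ContinuousOn (sqDistInterp P Q x y) (Ici 0) :=
  P.continuousOn_interpolate one_ne_zero fun _ =>
    Q.continuousOn_interpolate one_ne_zero fun _ => continuousOn_const

/-! ### Comparison of two discrete solutions -/

/-- The energy dissipated before time `t^k`, each drop being weighted by the length of its step. -/
def dissipation (P : TimePartition) (f : ℕ → ℝ) (k : ℕ) : ℝ :=
  ∑ i ∈ Finset.range k, (P.pt (i + 1) - P.pt i) * (f i - f (i + 1))

/-- The error accumulated up to time `t` by a discrete solution with energies `f`: the primitive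
of `(2 (1 - w) + κ + 2 μ p (1 - w)²) (f k - f (k + 1))`, where `w` is the affine parameter of the
cell of `t`. -/
def accumulatedError (P : TimePartition) (μ κ p : ℝ) (f : ℕ → ℝ) (t : ℝ) : ℝ :=
  P.interpolate 2 (dissipation P f) t + κ * P.interpolate 1 (dissipation P f) t
    + 2 * μ * p / 3 * P.interpolate 3 (dissipation P f) t

section Dissipation

variable {P : TimePartition} {f : ℕ → ℝ}

theorem dissipation_slope (P : TimePartition) (f : ℕ → ℝ) (k : ℕ) :
    (dissipation P f (k + 1) - dissipation P f k) / (P.pt (k + 1) - P.pt k) = f k - f (k + 1) := by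
  rw [dissipation, Finset.sum_range_succ, dissipation, add_sub_cancel_left,
    mul_div_cancel_left₀ _ (P.step_pos k).ne']

theorem dissipation_mono (hf : Antitone f) : Monotone (dissipation P f) := by
  refine monotone_nat_of_le_succ fun k => ?_
  rw [dissipation, dissipation, Finset.sum_range_succ]
  exact le_add_of_nonneg_right
    (mul_nonneg (P.step_pos k).le (sub_nonneg.2 (hf k.le_succ)))

theorem dissipation_le (hf : Antitone f) {p : ℝ} (hp : ∀ k, P.pt (k + 1) - P.pt k ≤ p) (k : ℕ) :
    dissipation P f k ≤ p * (f 0 - f k) := by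
  rw [← Finset.sum_range_sub', Finset.mul_sum]
  exact Finset.sum_le_sum fun i _ =>
    mul_le_mul_of_nonneg_right (hp i) (sub_nonneg.2 (hf i.le_succ))

theorem interpolate_dissipation_le (n : ℕ) (hf : Antitone f) {p : ℝ}
    (hp : ∀ k, P.pt (k + 1) - P.pt k ≤ p) {t T : ℝ} (ht : t ∈ Icc 0 T) :
    P.interpolate n (dissipation P f) t ≤ p * (f 0 - f (P.index T)) :=
  (P.interpolate_le_of_monotone n (dissipation_mono hf) ht.1).trans
    ((dissipation_mono hf (P.index_mono ht.2)).trans (dissipation_le hf hp _))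

theorem continuousOn_interpolate_dissipation {n : ℕ} (hn : n ≠ 0) :
    ContinuousOn (P.interpolate n (dissipation P f)) (Ici 0) :=
  P.continuousOn_interpolate hn fun _ => continuousOn_const

theorem interpolate_dissipation_zero (n : ℕ) : P.interpolate n (dissipation P f) 0 = 0 := by
  rw [P.interpolate_zero_right, dissipation, Finset.sum_range_zero]

theorem hasDerivWithinAt_interpolate_dissipation {n : ℕ} (hn : n ≠ 0) {k : ℕ} {t : ℝ}
    (ht : t ∈ Ico (P.pt k) (P.pt (k + 1))) :
    HasDerivWithinAt (P.interpolate n (dissipation P f))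
      (n * (1 - P.weight k t) ^ (n - 1) * (f k - f (k + 1))) (Ici t) t := by
  rw [← dissipation_slope P f k]
  exact P.hasDerivWithinAt_interpolate_const hn _ ht

variable {μ κ p : ℝ}

theorem accumulatedError_le (hμ : 0 ≤ μ) (hκ : 0 ≤ κ) (hf : Antitone f)
    (hp : ∀ k, P.pt (k + 1) - P.pt k ≤ p) {t T : ℝ} (ht : t ∈ Icc 0 T) :
    accumulatedError P μ κ p f t ≤ (1 + κ + 2 * μ / 3 * p) * (p * (f 0 - f (P.index T))) := by
  have hp0 : 0 ≤ p := (P.step_pos 0).le.trans (hp 0)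
  have h1 := mul_le_mul_of_nonneg_left (interpolate_dissipation_le 1 hf hp ht) hκ
  have h3 := mul_le_mul_of_nonneg_left (interpolate_dissipation_le 3 hf hp ht)
    (show 0 ≤ 2 * μ * p / 3 by positivity)
  rw [accumulatedError]
  linarith [interpolate_dissipation_le 2 hf hp ht]

theorem continuousOn_accumulatedError :
    ContinuousOn (accumulatedError P μ κ p f) (Ici 0) :=
  ((continuousOn_interpolate_dissipation two_ne_zero).add
    ((continuousOn_interpolate_dissipation one_ne_zero).const_mul κ)).add
      ((continuousOn_interpolate_dissipation three_ne_zero).const_mul _)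

theorem accumulatedError_zero : accumulatedError P μ κ p f 0 = 0 := by
  simp only [accumulatedError, interpolate_dissipation_zero, mul_zero, add_zero]

theorem hasDerivWithinAt_accumulatedError {k : ℕ} {t : ℝ}
    (ht : t ∈ Ico (P.pt k) (P.pt (k + 1))) :
    HasDerivWithinAt (accumulatedError P μ κ p f)
      ((2 * (1 - P.weight k t) + κ + 2 * μ * p * (1 - P.weight k t) ^ 2) * (f k - f (k + 1)))
      (Ici t) t := by
  refine (((hasDerivWithinAt_interpolate_dissipation two_ne_zero ht).add
    ((hasDerivWithinAt_interpolate_dissipation one_ne_zero ht).const_mul κ)).add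
      ((hasDerivWithinAt_interpolate_dissipation three_ne_zero ht).const_mul _)).congr_deriv ?_
  norm_num
  ring

end Dissipation

namespace IsDiscreteSolution

variable {P : TimePartition} {x₀ : X} {x : ℕ → X} {μ κ p : ℝ}

theorem lerp_slope_le (hx : IsDiscreteSolution φ P x₀ x) (hbot : ∀ x, φ x ≠ ⊥) (hμ : 0 ≤ μ)
    (hκ : 0 ≤ κ) (hevi : DiscreteEVI φ μ κ) (hx₀ : φ x₀ ≠ ⊤)
    (hp : ∀ k, P.pt (k + 1) - P.pt k ≤ p) (k : ℕ) {z₀ z₁ : X} (hz₀ : φ z₀ ≠ ⊤) (hz₁ : φ z₁ ≠ ⊤)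
    {w m : ℝ} (hw : w ∈ Icc (0 : ℝ) 1) (hm : m ∈ Icc (0 : ℝ) 1) {v : X → ℝ}
    (hv : ∀ z, v z = dist (x k) z ^ 2 + w * (dist (x (k + 1)) z ^ 2 - dist (x k) z ^ 2)) {σ : X → ℝ}
    (hσ : ∀ z, σ z = (dist (x (k + 1)) z ^ 2 - dist (x k) z ^ 2) / (P.pt (k + 1) - P.pt k)) :
    σ z₀ + m * (σ z₁ - σ z₀) ≤
      2 * (((φ z₀).toReal + m * ((φ z₁).toReal - (φ z₀).toReal))
        - ((φ (x k)).toReal + w * ((φ (x (k + 1))).toReal - (φ (x k)).toReal)))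
      + μ * (v z₀ + m * (v z₁ - v z₀))
      + 2 * μ * ((1 - w) * dist (x k) (x (k + 1))) * √(v z₀ + m * (v z₁ - v z₀))
      + (2 * (1 - w) + κ + 2 * μ * p * (1 - w) ^ 2)
        * ((φ (x k)).toReal - (φ (x (k + 1))).toReal) := by
  have hslope : ∀ z, φ z ≠ ⊤ → _ := fun z hz =>
    (hσ z).trans_le <| slope_le_of_evi (P.step_pos k) dist_nonneg hκ hμ
      (by linarith [dist_triangle (x (k + 1)) (x k) z, dist_comm (x k) (x (k + 1))])
      (hevi _ _ _ _ (P.step_pos k) (hx.ne_top hx₀ k) hz (hx.2 k))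
      (hx.sq_dist_le hbot hx₀ k) (hp k) hw (hv z)
  have hv0 : ∀ z, 0 ≤ v z := fun z => by
    rw [hv]
    nlinarith [hw.1, hw.2, sq_nonneg (dist (x k) z), sq_nonneg (dist (x (k + 1)) z)]
  have hE : 0 ≤ 2 * μ * ((1 - w) * dist (x k) (x (k + 1))) :=
    mul_nonneg (mul_nonneg zero_le_two hμ) (mul_nonneg (sub_nonneg.2 hw.2) dist_nonneg)
  have hsqrt := mul_le_mul_of_nonneg_left (sqrt_lerp_le (hv0 z₀) (hv0 z₁) hm) hE
  linarith [mul_le_mul_of_nonneg_left (hslope z₀ hz₀) (sub_nonneg.2 hm.2),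
    mul_le_mul_of_nonneg_left (hslope z₁ hz₁) hm.1]

end IsDiscreteSolution

section Comparison

variable {P Q : TimePartition} {x₀ : X} {x y : ℕ → X} {μ κ p q : ℝ}

/-- The right derivative of the interpolated squared distance is the sum of the averaged slopes in
either variable; in the sum of the two variational inequalities the energies cancel. -/
theorem exists_hasDerivWithinAt_sqDistInterp (hbot : ∀ x, φ x ≠ ⊥) (hμ : 0 ≤ μ) (hκ : 0 ≤ κ)
    (hevi : DiscreteEVI φ μ κ) (hx₀ : φ x₀ ≠ ⊤) (hx : IsDiscreteSolution φ P x₀ x)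
    (hy : IsDiscreteSolution φ Q x₀ y) (hp : ∀ k, P.pt (k + 1) - P.pt k ≤ p)
    (hq : ∀ k, Q.pt (k + 1) - Q.pt k ≤ q) {k j : ℕ} {t : ℝ}
    (hk : t ∈ Ico (P.pt k) (P.pt (k + 1))) (hj : t ∈ Ico (Q.pt j) (Q.pt (j + 1))) :
    ∃ u', HasDerivWithinAt (sqDistInterp P Q x y) u' (Ici t) t ∧
      u' ≤ 2 * μ * sqDistInterp P Q x y t
        + 2 * μ * ((1 - P.weight k t) * dist (x k) (x (k + 1))
          + (1 - Q.weight j t) * dist (y j) (y (j + 1))) * √(sqDistInterp P Q x y t)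
        + (2 * (1 - P.weight k t) + κ + 2 * μ * p * (1 - P.weight k t) ^ 2)
          * ((φ (x k)).toReal - (φ (x (k + 1))).toReal)
        + (2 * (1 - Q.weight j t) + κ + 2 * μ * q * (1 - Q.weight j t) ^ 2)
          * ((φ (y j)).toReal - (φ (y (j + 1))).toReal) := by
  have hw := P.weight_mem_Icc (Ico_subset_Icc_self hk)
  have hm := Q.weight_mem_Icc (Ico_subset_Icc_self hj)
  have hux := hx.lerp_slope_le hbot hμ hκ hevi hx₀ hp k (hy.ne_top hx₀ j) (hy.ne_top hx₀ (j + 1))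
    hw hm (fun _ => rfl) (fun _ => rfl)
  have huy := hy.lerp_slope_le hbot hμ hκ hevi hx₀ hq j (hx.ne_top hx₀ k) (hx.ne_top hx₀ (k + 1))
    hm hw (fun _ => rfl) (fun _ => rfl)
  simp only [dist_comm (y _) (x _)] at huy
  have hu' := P.hasDerivWithinAt_interpolate one_ne_zero hk fun i =>
    Q.hasDerivWithinAt_interpolate_const one_ne_zero (fun j => dist (x i) (y j) ^ 2) hj
  refine ⟨_, hu', ?_⟩
  simp only [sqDistInterp, P.interpolate_one_of_mem_Icc _ (Ico_subset_Icc_self hk),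
    Q.interpolate_one_of_mem_Icc _ (Ico_subset_Icc_self hj), Nat.cast_one, pow_one, one_mul,
    Nat.sub_self, pow_zero, sub_sub_cancel]
  set w := P.weight k t
  set m := Q.weight j t
  set a := dist (x k) (y j) ^ 2
  set b := dist (x (k + 1)) (y j) ^ 2
  set c := dist (x k) (y (j + 1)) ^ 2
  set d := dist (x (k + 1)) (y (j + 1)) ^ 2
  have hcomm : a + w * (b - a) + m * (c + w * (d - c) - (a + w * (b - a))) =
    a + m * (c - a) + w * (b + m * (d - b) - (a + m * (c - a))) := by ring
  rw [hcomm] at hux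
  have hslope : (b + m * (d - b) - (a + m * (c - a))) / (P.pt (k + 1) - P.pt k) =
    (b - a) / (P.pt (k + 1) - P.pt k) + m * ((d - c) / (P.pt (k + 1) - P.pt k)
      - (b - a) / (P.pt (k + 1) - P.pt k)) := by ring
  rw [hslope]
  linarith

/-- The constant of the error estimate: two discrete solutions differ at time `t` by at most
`exp (μ t)` times the sum of `errorConst μ κ p * √(p * Δ)` over both of them, with `p` a bound on
the steps and `Δ` the drop of the energy. -/
def errorConst (μ κ p : ℝ) : ℝ := √(1 + κ + 2 * μ / 3 * p) + √(4 * μ / 3 * p)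

theorem errorConst_nonneg (μ κ p : ℝ) : 0 ≤ errorConst μ κ p :=
  add_nonneg (Real.sqrt_nonneg _) (Real.sqrt_nonneg _)

theorem errorConst_mono {μ κ : ℝ} (hμ : 0 ≤ μ) : Monotone (errorConst μ κ) := by
  intro p q hpq
  unfold errorConst
  gcongr

/-- The contribution of one discrete solution to the coefficient of the square root in the
differential inequality for `e^{-2μt} u`, where `u` is the interpolated squared distance. -/
def sqrtError (P : TimePartition) (μ p s : ℝ) (f : ℕ → ℝ) (t : ℝ) : ℝ :=
  s * (1 - Real.exp (-2 * μ * t)) + μ * p / (3 * s) * P.interpolate 3 (dissipation P f) t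

section SqrtError

variable {f : ℕ → ℝ} {s : ℝ}

theorem sqrtError_le (hμ : 0 ≤ μ) (hs : 0 < s) (hf : Antitone f)
    (hp : ∀ k, P.pt (k + 1) - P.pt k ≤ p) {t T : ℝ} (ht : t ∈ Icc 0 T) :
    sqrtError P μ p s f t ≤ s + μ / 3 * p * (p * (f 0 - f (P.index T))) / s := by
  have hp0 : 0 ≤ p := (P.step_pos 0).le.trans (hp 0)
  have h3 := mul_le_mul_of_nonneg_left (interpolate_dissipation_le 3 hf hp ht)
    (show 0 ≤ μ * p / (3 * s) by positivity)
  have hexp := mul_nonneg hs.le (Real.exp_pos (-2 * μ * t)).le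
  have e : μ * p / (3 * s) * (p * (f 0 - f (P.index T))) =
    μ / 3 * p * (p * (f 0 - f (P.index T))) / s := by field_simp
  rw [sqrtError]
  linarith

theorem continuousOn_sqrtError : ContinuousOn (sqrtError P μ p s f) (Ici 0) :=
  (by fun_prop : Continuous fun t => s * (1 - Real.exp (-2 * μ * t))).continuousOn.add
    ((continuousOn_interpolate_dissipation three_ne_zero).const_mul _)

theorem sqrtError_zero : sqrtError P μ p s f 0 = 0 := by
  simp [sqrtError, interpolate_dissipation_zero]

theorem hasDerivWithinAt_exp_mul (c t : ℝ) :
    HasDerivWithinAt (fun t => Real.exp (c * t)) (c * Real.exp (c * t)) (Ici t) t := by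
  simpa [mul_comm] using ((hasDerivAt_id t).const_mul c).exp.hasDerivWithinAt

theorem hasDerivWithinAt_sqrtError {k : ℕ} {t : ℝ} (ht : t ∈ Ico (P.pt k) (P.pt (k + 1))) :
    HasDerivWithinAt (sqrtError P μ p s f)
      (2 * μ * s * Real.exp (-2 * μ * t)
        + μ * p / s * ((1 - P.weight k t) ^ 2 * (f k - f (k + 1)))) (Ici t) t := by
  refine ((((hasDerivWithinAt_exp_mul (-2 * μ) t).const_sub 1).const_mul s).add
    ((hasDerivWithinAt_interpolate_dissipation three_ne_zero ht).const_mul _)).congr_deriv ?_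
  norm_num
  ring

end SqrtError

theorem IsDiscreteSolution.step_le_sqrtError_deriv (hx : IsDiscreteSolution φ P x₀ x)
    (hbot : ∀ x, φ x ≠ ⊥) (hx₀ : φ x₀ ≠ ⊤) (hμ : 0 ≤ μ) (hp : ∀ k, P.pt (k + 1) - P.pt k ≤ p)
    {s : ℝ} (hs : 0 < s) (k : ℕ) (w t : ℝ) :
    2 * μ * Real.exp (-μ * t) * ((1 - w) * dist (x k) (x (k + 1))) ≤
      2 * μ * s * Real.exp (-2 * μ * t)
        + μ * p / s * ((1 - w) ^ 2 * ((φ (x k)).toReal - (φ (x (k + 1))).toReal)) := by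
  have hexp : Real.exp (-μ * t) ^ 2 = Real.exp (-2 * μ * t) := by
    rw [← Real.exp_nat_mul]
    congr 1
    push_cast
    ring
  have hΔ : 0 ≤ (φ (x k)).toReal - (φ (x (k + 1))).toReal :=
    sub_nonneg.2 (hx.antitone hbot hx₀ k.le_succ)
  have hD : dist (x k) (x (k + 1)) ^ 2 ≤ 2 * p * ((φ (x k)).toReal - (φ (x (k + 1))).toReal) :=
    (hx.sq_dist_le hbot hx₀ k).trans (by gcongr; exact hp k)
  calc 2 * μ * Real.exp (-μ * t) * ((1 - w) * dist (x k) (x (k + 1)))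
      = μ * (2 * Real.exp (-μ * t) * ((1 - w) * dist (x k) (x (k + 1)))) := by ring
    _ ≤ μ * (2 * s * Real.exp (-μ * t) ^ 2
        + ((1 - w) * dist (x k) (x (k + 1))) ^ 2 / (2 * s)) := by
      gcongr
      exact two_mul_mul_le_add_div hs _ _
    _ ≤ μ * (2 * s * Real.exp (-2 * μ * t)
        + (1 - w) ^ 2 * (2 * p * ((φ (x k)).toReal - (φ (x (k + 1))).toReal)) / (2 * s)) := by
      rw [hexp, mul_pow]
      gcongr
    _ = _ := by field_simp

theorem exists_hasDerivWithinAt_exp_mul_sqDistInterp (hbot : ∀ x, φ x ≠ ⊥) (hμ : 0 ≤ μ)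
    (hκ : 0 ≤ κ) (hevi : DiscreteEVI φ μ κ) (hx₀ : φ x₀ ≠ ⊤) (hx : IsDiscreteSolution φ P x₀ x)
    (hy : IsDiscreteSolution φ Q x₀ y) (hp : ∀ k, P.pt (k + 1) - P.pt k ≤ p)
    (hq : ∀ k, Q.pt (k + 1) - Q.pt k ≤ q) {s r : ℝ} (hs : 0 < s) (hr : 0 < r) {t : ℝ}
    (ht : 0 ≤ t) :
    ∃ U' A' B',
      HasDerivWithinAt (fun t => Real.exp (-2 * μ * t) * sqDistInterp P Q x y t) U' (Ici t) t ∧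
      HasDerivWithinAt (fun t => accumulatedError P μ κ p (fun k => (φ (x k)).toReal) t
        + accumulatedError Q μ κ q (fun k => (φ (y k)).toReal) t) A' (Ici t) t ∧
      HasDerivWithinAt (fun t => sqrtError P μ p s (fun k => (φ (x k)).toReal) t
        + sqrtError Q μ q r (fun k => (φ (y k)).toReal) t) B' (Ici t) t ∧
      0 ≤ B' ∧ U' ≤ A' + B' * √(Real.exp (-2 * μ * t) * sqDistInterp P Q x y t) := by
  obtain ⟨k, hk⟩ := P.exists_mem_Ico ht
  obtain ⟨j, hj⟩ := Q.exists_mem_Ico ht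
  obtain ⟨u', hu', hle⟩ :=
    exists_hasDerivWithinAt_sqDistInterp hbot hμ hκ hevi hx₀ hx hy hp hq hk hj
  have hBx := hx.step_le_sqrtError_deriv hbot hx₀ hμ hp hs k (P.weight k t) t
  have hBy := hy.step_le_sqrtError_deriv hbot hx₀ hμ hq hr j (Q.weight j t) t
  have hw := sub_nonneg.2 (P.weight_mem_Icc (Ico_subset_Icc_self hk)).2
  have hm := sub_nonneg.2 (Q.weight_mem_Icc (Ico_subset_Icc_self hj)).2
  have hf := sub_nonneg.2 (hx.antitone hbot hx₀ k.le_succ)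
  have hg := sub_nonneg.2 (hy.antitone hbot hx₀ j.le_succ)
  have hp0 : 0 ≤ p := (P.step_pos 0).le.trans (hp 0)
  have hq0 : 0 ≤ q := (Q.step_pos 0).le.trans (hq 0)
  refine ⟨_, _, _, (hasDerivWithinAt_exp_mul (-2 * μ) t).mul hu',
    (hasDerivWithinAt_accumulatedError hk).add (hasDerivWithinAt_accumulatedError hj),
    (hasDerivWithinAt_sqrtError hk).add (hasDerivWithinAt_sqrtError hj),
    (by positivity : (0 : ℝ) ≤ _).trans (add_le_add hBx hBy), ?_⟩
  have hE1 : Real.exp (-2 * μ * t) ≤ 1 := Real.exp_le_one_iff.2 (by nlinarith)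
  have hE : Real.exp (-2 * μ * t) = Real.exp (-μ * t) * Real.exp (-μ * t) := by
    rw [← Real.exp_add]
    ring_nf
  have hsqrt : √(Real.exp (-2 * μ * t) * sqDistInterp P Q x y t) =
      Real.exp (-μ * t) * √(sqDistInterp P Q x y t) := by
    rw [hE, Real.sqrt_mul (by positivity), Real.sqrt_mul_self (by positivity)]
  have herr := mul_le_mul_of_nonneg_right hE1 (add_nonneg
    (mul_nonneg (by positivity : 0 ≤ 2 * (1 - P.weight k t) + κ
      + 2 * μ * p * (1 - P.weight k t) ^ 2) hf)
    (mul_nonneg (by positivity : 0 ≤ 2 * (1 - Q.weight j t) + κ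
      + 2 * μ * q * (1 - Q.weight j t) ^ 2) hg))
  have hB := mul_le_mul_of_nonneg_right (add_le_add hBx hBy)
    (Real.sqrt_nonneg (Real.exp (-2 * μ * t) * sqDistInterp P Q x y t))
  refine le_trans ?_ (add_le_add (herr.trans_eq (one_mul _)) hB)
  have h := mul_le_mul_of_nonneg_left hle (Real.exp_pos (-2 * μ * t)).le
  rw [hsqrt]
  rw [hE] at h ⊢
  linarith

theorem sqrt_exp_mul_sqDistInterp_le (hbot : ∀ x, φ x ≠ ⊥) (hμ : 0 ≤ μ) (hκ : 0 ≤ κ)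
    (hevi : DiscreteEVI φ μ κ) (hx₀ : φ x₀ ≠ ⊤) (hx : IsDiscreteSolution φ P x₀ x)
    (hy : IsDiscreteSolution φ Q x₀ y) (hp : ∀ k, P.pt (k + 1) - P.pt k ≤ p)
    (hq : ∀ k, Q.pt (k + 1) - Q.pt k ≤ q) {s r : ℝ} (hs : 0 < s) (hr : 0 < r) {T : ℝ}
    (hT : 0 ≤ T) :
    √(Real.exp (-2 * μ * T) * sqDistInterp P Q x y T) ≤
      √((1 + κ + 2 * μ / 3 * p) * (p * ((φ x₀).toReal - (φ (interp P x T)).toReal))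
          + (1 + κ + 2 * μ / 3 * q) * (q * ((φ x₀).toReal - (φ (interp Q y T)).toReal)))
        + ((s + μ / 3 * p * (p * ((φ x₀).toReal - (φ (interp P x T)).toReal)) / s)
          + (r + μ / 3 * q * (q * ((φ x₀).toReal - (φ (interp Q y T)).toReal)) / r)) := by
  set f : ℕ → ℝ := fun k => (φ (x k)).toReal
  set g : ℕ → ℝ := fun k => (φ (y k)).toReal
  have hf : Antitone f := hx.antitone hbot hx₀
  have hg : Antitone g := hy.antitone hbot hx₀
  rw [show (φ x₀).toReal - (φ (interp P x T)).toReal = f 0 - f (P.index T) by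
      simp only [f, hx.1, interp],
    show (φ x₀).toReal - (φ (interp Q y T)).toReal = g 0 - g (Q.index T) by
      simp only [g, hy.1, interp]]
  refine sqrt_le_of_deriv_right_le_add_mul_sqrt (U := fun t => Real.exp (-2 * μ * t) *
      sqDistInterp P Q x y t) (A := fun t => accumulatedError P μ κ p f t +
      accumulatedError Q μ κ q g t) (B := fun t => sqrtError P μ p s f t + sqrtError Q μ q r g t)
    hT ((by fun_prop : Continuous fun t => Real.exp (-2 * μ * t)).continuousOn.mul
      (continuousOn_sqDistInterp P Q x y))
    (continuousOn_accumulatedError.add continuousOn_accumulatedError)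
    (continuousOn_sqrtError.add continuousOn_sqrtError) ?_
    (by simp only [accumulatedError_zero, add_zero]) (by simp only [sqrtError_zero, add_zero])
    (fun t ht => add_le_add (accumulatedError_le hμ hκ hf hp ht)
      (accumulatedError_le hμ hκ hg hq ht))
    (fun t ht => add_le_add (sqrtError_le hμ hs hf hp ht) (sqrtError_le hμ hr hg hq ht))
    (fun t ht => exists_hasDerivWithinAt_exp_mul_sqDistInterp hbot hμ hκ hevi hx₀ hx hy hp hq hs hr
      ht)
  simp [sqDistInterp, P.interpolate_zero_right, Q.interpolate_zero_right, hx.1, hy.1]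

theorem sqrt_sqDistInterp_le (hbot : ∀ x, φ x ≠ ⊥) (hμ : 0 ≤ μ) (hκ : 0 ≤ κ)
    (hevi : DiscreteEVI φ μ κ) (hx₀ : φ x₀ ≠ ⊤) (hx : IsDiscreteSolution φ P x₀ x)
    (hy : IsDiscreteSolution φ Q x₀ y) (hp : ∀ k, P.pt (k + 1) - P.pt k ≤ p)
    (hq : ∀ k, Q.pt (k + 1) - Q.pt k ≤ q) {t : ℝ} (ht : 0 ≤ t) :
    √(sqDistInterp P Q x y t) ≤ Real.exp (μ * t) *
      (errorConst μ κ p * √(p * ((φ x₀).toReal - (φ (interp P x t)).toReal))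
        + errorConst μ κ q * √(q * ((φ x₀).toReal - (φ (interp Q y t)).toReal))) := by
  have hp0 : 0 ≤ p := (P.step_pos 0).le.trans (hp 0)
  have hq0 : 0 ≤ q := (Q.step_pos 0).le.trans (hq 0)
  set a := p * ((φ x₀).toReal - (φ (interp P x t)).toReal)
  set b := q * ((φ x₀).toReal - (φ (interp Q y t)).toReal)
  have ha : 0 ≤ a := mul_nonneg hp0 (hx.energy_drop_nonneg hbot hx₀ t)
  have hb : 0 ≤ b := mul_nonneg hq0 (hy.energy_drop_nonneg hbot hx₀ t)
  have hopt : √(Real.exp (-2 * μ * t) * sqDistInterp P Q x y t) ≤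
      √((1 + κ + 2 * μ / 3 * p) * a + (1 + κ + 2 * μ / 3 * q) * b)
        + 2 * √(μ / 3 * p * a) + 2 * √(μ / 3 * q * b) :=
    le_add_two_mul_sqrt (by positivity) fun r hr => by
      rw [add_right_comm]
      refine le_add_two_mul_sqrt (by positivity) fun s hs => ?_
      linarith [sqrt_exp_mul_sqDistInterp_le hbot hμ hκ hevi hx₀ hx hy hp hq hs hr ht]
  have hsplit : ∀ {c e : ℝ}, 0 ≤ c → 2 * √(μ / 3 * c * e) = √(4 * μ / 3 * c) * √e :=
    fun {c e} hc => by
      rw [show 4 * μ / 3 * c = 2 ^ 2 * (μ / 3 * c) by ring, Real.sqrt_mul (by positivity) e,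
        Real.sqrt_mul (by positivity) (μ / 3 * c), Real.sqrt_sq zero_le_two, mul_assoc]
  have hsqrt : √(Real.exp (-2 * μ * t) * sqDistInterp P Q x y t) =
      (Real.exp (μ * t))⁻¹ * √(sqDistInterp P Q x y t) := by
    rw [Real.sqrt_mul (Real.exp_pos _).le, ← Real.exp_neg, ← Real.exp_half]
    ring_nf
  rw [← inv_mul_le_iff₀ (Real.exp_pos _), ← hsqrt]
  refine hopt.trans ?_
  have hadd := sqrt_add_le_add_sqrt (a := (1 + κ + 2 * μ / 3 * p) * a)
    (b := (1 + κ + 2 * μ / 3 * q) * b) (by positivity) (by positivity)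
  rw [Real.sqrt_mul (by positivity) a, Real.sqrt_mul (by positivity) b] at hadd
  rw [hsplit hp0, hsplit hq0, errorConst, errorConst]
  linarith

end Comparison

/-! ### A priori bound of the energy -/

theorem discrete_gronwall {P : TimePartition} {f : ℕ → ℝ} {L : ℝ} (hL : 0 ≤ L) (hf : ∀ k, 0 ≤ f k)
    (hstep : ∀ k, L * (P.pt (k + 1) - P.pt k) ≤ 1 / 2)
    (h : ∀ k, f (k + 1) ≤ f k + L * (P.pt (k + 1) - P.pt k) * f (k + 1)) (k : ℕ) :
    f k ≤ f 0 * Real.exp (2 * L * P.pt k) := by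
  induction k with
  | zero => simp [P.pt_zero]
  | succ k ih =>
    set u := L * (P.pt (k + 1) - P.pt k) with hu
    have hu0 : 0 ≤ u := mul_nonneg hL (P.step_pos k).le
    have hu1 : 1 ≤ (1 + 2 * u) * (1 - u) := by nlinarith [hstep k]
    calc f (k + 1) ≤ (1 + 2 * u) * (1 - u) * f (k + 1) := le_mul_of_one_le_left (hf _) hu1
      _ = (1 + 2 * u) * (f (k + 1) - u * f (k + 1)) := by ring
      _ ≤ (1 + 2 * u) * f k := by
        gcongr
        linarith [h k]
      _ ≤ Real.exp (2 * u) * f k := by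
        gcongr
        · exact hf k
        · exact (add_comm _ _).trans_le (Real.add_one_le_exp _)
      _ ≤ Real.exp (2 * u) * (f 0 * Real.exp (2 * L * P.pt k)) := by gcongr
      _ = f 0 * Real.exp (2 * L * P.pt (k + 1)) := by
        rw [mul_left_comm, ← Real.exp_add, hu]
        ring_nf

theorem sq_le_sq_add_of_le_add {a b D ε η Δ : ℝ} (ha : 0 ≤ a) (hb : 0 ≤ b) (hab : b ≤ a + D)
    (hε : 0 < ε) (hη : 0 < η) (hDΔ : D ^ 2 ≤ 2 * η * Δ) :
    b ^ 2 ≤ a ^ 2 + 2 * ε * Δ + η / ε * b ^ 2 := by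
  have hAMGM := two_mul_mul_le_add_div (s := ε / (2 * η)) (by positivity) D b
  have hD : 2 * (ε / (2 * η)) * D ^ 2 ≤ 2 * ε * Δ := by
    calc 2 * (ε / (2 * η)) * D ^ 2 ≤ 2 * (ε / (2 * η)) * (2 * η * Δ) := by gcongr
      _ = 2 * ε * Δ := by field_simp
  have hdiv : b ^ 2 / (2 * (ε / (2 * η))) = η / ε * b ^ 2 := by field_simp
  have hsq : b ^ 2 ≤ a ^ 2 + 2 * D * b := by
    rcases le_total b D with h | h <;> nlinarith
  linarith

theorem exists_energy_drop_le_of_moreauYosida_ne_bot (hbot : ∀ x, φ x ≠ ⊥) {τ : ℝ} {x₀ : X}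
    (h : moreauYosida φ τ x₀ ≠ ⊥) :
    ∃ C : ℝ, ∀ z, φ z ≠ ⊤ → (φ x₀).toReal - (φ z).toReal ≤ C + dist x₀ z ^ 2 / (2 * τ) := by
  refine ⟨(φ x₀).toReal - (moreauYosida φ τ x₀).toReal, fun z hz => ?_⟩
  have hle : moreauYosida φ τ x₀ ≤
      (((φ z).toReal + dist x₀ z ^ 2 / (2 * τ) : ℝ) : EReal) := by
    rw [EReal.coe_add, EReal.coe_toReal hz (hbot z)]
    exact iInf_le _ z
  linarith [EReal.toReal_le_toReal hle h (EReal.coe_ne_top _),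
    EReal.toReal_coe ((φ z).toReal + dist x₀ z ^ 2 / (2 * τ))]

/-- The quantity `d²(x₀, x^k) + τ (φ(x^k) - φ(x₀) + C)` controls `d²(x₀, x^k) / 2` and grows at
most exponentially. -/
theorem IsDiscreteSolution.energy_drop_le {P : TimePartition} {x₀ : X} {x : ℕ → X}
    (hx : IsDiscreteSolution φ P x₀ x) (hbot : ∀ x, φ x ≠ ⊥) (hx₀ : φ x₀ ≠ ⊤) {τ C : ℝ}
    (hτ : 0 < τ)
    (hC : ∀ z, φ z ≠ ⊤ → (φ x₀).toReal - (φ z).toReal ≤ C + dist x₀ z ^ 2 / (2 * τ))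
    (hP : ∀ k, P.pt (k + 1) - P.pt k ≤ τ / 8) (k : ℕ) :
    (φ x₀).toReal - (φ (x k)).toReal ≤ C * (1 + Real.exp (8 / τ * P.pt k)) := by
  set f : ℕ → ℝ := fun k =>
    dist x₀ (x k) ^ 2 + τ * ((φ (x k)).toReal - (φ x₀).toReal + C) with hf
  have hdist : ∀ k, dist x₀ (x k) ^ 2 ≤ 2 * f k := fun k => by
    have h := mul_le_mul_of_nonneg_left (hC (x k) (hx.ne_top hx₀ k)) hτ.le
    rw [mul_add, show τ * (dist x₀ (x k) ^ 2 / (2 * τ)) = dist x₀ (x k) ^ 2 / 2 by field_simp] at h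
    simp only [hf]
    linarith
  have hstep : ∀ k, f (k + 1) ≤ f k + 4 / τ * (P.pt (k + 1) - P.pt k) * f (k + 1) := fun k => by
    have hτk := P.step_pos k
    have h := sq_le_sq_add_of_le_add (dist_nonneg (x := x₀) (y := x k))
      (dist_nonneg (x := x₀) (y := x (k + 1))) (dist_triangle _ _ _) (half_pos hτ) hτk
      (hx.sq_dist_le hbot hx₀ k)
    have hgrow := mul_le_mul_of_nonneg_left (hdist (k + 1))
      (show 0 ≤ (P.pt (k + 1) - P.pt k) / (τ / 2) by positivity)
    rw [show (P.pt (k + 1) - P.pt k) / (τ / 2) * (2 * f (k + 1)) =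
      4 / τ * (P.pt (k + 1) - P.pt k) * f (k + 1) by field_simp; ring] at hgrow
    simp only [hf] at hgrow ⊢
    linarith
  have hgronwall := discrete_gronwall (by positivity)
    (fun k => by linarith [hdist k, sq_nonneg (dist x₀ (x k))])
    (fun k => (mul_le_mul_of_nonneg_left (hP k) (by positivity)).trans_eq (by field_simp; norm_num))
    hstep k
  have hf0 : f 0 = τ * C := by simp [hf, hx.1]
  rw [hf0, show 2 * (4 / τ) = 8 / τ by ring] at hgronwall
  calc (φ x₀).toReal - (φ (x k)).toReal
      ≤ C + dist x₀ (x k) ^ 2 / (2 * τ) := hC _ (hx.ne_top hx₀ k)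
    _ ≤ C + 2 * (τ * C * Real.exp (8 / τ * P.pt k)) / (2 * τ) := by
      gcongr
      linarith [hdist k]
    _ = C * (1 + Real.exp (8 / τ * P.pt k)) := by field_simp

theorem TimePartition.step_le_of_mesh_lt (P : TimePartition) {δ : ℝ}
    (h : P.mesh < ENNReal.ofReal δ) (k : ℕ) : P.pt (k + 1) - P.pt k ≤ δ :=
  ((ENNReal.ofReal_lt_ofReal_iff_of_nonneg (P.step_pos k).le).1
    ((P.ofReal_step_le_mesh k).trans_lt h)).le

theorem TimePartition.pt_index_le (P : TimePartition) {p : ℝ}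
    (hp : ∀ k, P.pt (k + 1) - P.pt k ≤ p) {t : ℝ} (ht : 0 ≤ t) : P.pt (P.index t) ≤ t + p := by
  have hle := P.pt_index_pred_le ht
  cases h : P.index t with
  | zero => linarith [P.pt_zero, P.step_pos 0, hp 0]
  | succ k =>
    rw [h, Nat.add_sub_cancel] at hle
    linarith [hp k]

theorem exists_energy_drop_le (hbot : ∀ x, φ x ≠ ⊥) {τ : ℝ} (hτ : 0 < τ) {x₀ : X}
    (hx₀ : φ x₀ ≠ ⊤) (h : moreauYosida φ τ x₀ ≠ ⊥) (T : ℝ) :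
    ∃ H δ : ℝ, 0 < δ ∧ ∀ (P : TimePartition) (x : ℕ → X), IsDiscreteSolution φ P x₀ x →
      P.mesh < ENNReal.ofReal δ → ∀ t ∈ Icc 0 T,
        (φ x₀).toReal - (φ (interp P x t)).toReal ≤ H := by
  obtain ⟨C, hC⟩ := exists_energy_drop_le_of_moreauYosida_ne_bot hbot h
  have hC0 : 0 ≤ C := by simpa using hC x₀ hx₀
  refine ⟨C * (1 + Real.exp (8 / τ * (T + τ / 8))), τ / 8, by positivity,
    fun P x hx hP t ht => ?_⟩
  have hstep := P.step_le_of_mesh_lt hP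
  refine (hx.energy_drop_le hbot hx₀ hτ hC hstep (P.index t)).trans ?_
  gcongr
  exact (P.pt_index_le hstep ht.1).trans (by linarith [ht.2])

/-! ### Convergence of discrete solutions -/

theorem interpDist_eq_sqrt_interpolate (P : TimePartition) (x : ℕ → X) (t : ℝ) (y : X) :
    interpDist P x t y = √(P.interpolate 1 (fun k => dist (x k) y ^ 2) t) := by
  rw [interpDist, TimePartition.interpolate, pow_one, sub_sub_cancel]
  cases h : P.index t with
  | zero => simp
  | succ k => rfl

theorem TimePartition.le_sqrt_interpolate_add (P : TimePartition) {c : ℕ → ℝ} {t : ℝ} (ht : 0 ≤ t)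
    {d e : ℝ} (h₀ : d ≤ √(c (P.index t - 1)) + e) (h₁ : d ≤ √(c (P.index t)) + e) :
    d ≤ √(P.interpolate 1 c t) + e := by
  have hmin : d ≤ √(min (c (P.index t - 1)) (c (P.index t))) + e := by
    rcases min_choice (c (P.index t - 1)) (c (P.index t)) with h | h <;> rwa [h]
  exact hmin.trans (add_le_add_left (Real.sqrt_le_sqrt (P.interpolate_mem_uIcc 1 c ht).1) e)

theorem TimePartition.tendsto_interpolate (P : TimePartition) (n : ℕ) {ι : Type*} {L : Filter ι}
    {c : ι → ℕ → ℝ} {c₀ : ℕ → ℝ} (h : ∀ k, Tendsto (fun i => c i k) L (𝓝 (c₀ k))) (t : ℝ) :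
    Tendsto (fun i => P.interpolate n (c i) t) L (𝓝 (P.interpolate n c₀ t)) :=
  (h _).add (((h _).sub (h _)).const_mul _)

theorem dist_interp_le_sqrt_sqDistInterp_add (P Q : TimePartition) (x y : ℕ → X) {t : ℝ}
    (ht : 0 ≤ t) :
    dist (interp P x t) (interp Q y t) ≤ √(sqDistInterp P Q x y t)
      + (dist (x (P.index t - 1)) (x (P.index t)) + dist (y (Q.index t - 1)) (y (Q.index t))) := by
  have hx := dist_comm (x (P.index t - 1)) (x (P.index t))
  have hx0 := dist_nonneg (x := x (P.index t - 1)) (y := x (P.index t))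
  have hy0 := dist_nonneg (x := y (Q.index t - 1)) (y := y (Q.index t))
  refine P.le_sqrt_interpolate_add ht (Q.le_sqrt_interpolate_add ht ?_ ?_)
    (Q.le_sqrt_interpolate_add ht ?_ ?_) <;> rw [Real.sqrt_sq dist_nonneg, interp, interp]
  · linarith [dist_triangle4 (x (P.index t)) (x (P.index t - 1)) (y (Q.index t - 1))
      (y (Q.index t))]
  · linarith [dist_triangle (x (P.index t)) (x (P.index t - 1)) (y (Q.index t))]
  · linarith [dist_triangle (x (P.index t)) (y (Q.index t - 1)) (y (Q.index t))]
  · linarith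

theorem IsDiscreteSolution.dist_index_pred_le {P : TimePartition} {x₀ : X} {x : ℕ → X}
    (hx : IsDiscreteSolution φ P x₀ x) (hbot : ∀ x, φ x ≠ ⊥) (hx₀ : φ x₀ ≠ ⊤) {p : ℝ}
    (hp : ∀ k, P.pt (k + 1) - P.pt k ≤ p) (t : ℝ) :
    dist (x (P.index t - 1)) (x (P.index t)) ≤
      √(2 * (p * ((φ x₀).toReal - (φ (interp P x t)).toReal))) := by
  have hanti := hx.antitone hbot hx₀
  rw [interp]
  cases P.index t with
  | zero => simp
  | succ k =>
    refine Real.le_sqrt_of_sq_le ((hx.sq_dist_le hbot hx₀ k).trans ?_)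
    have hΔ : 0 ≤ (φ (x k)).toReal - (φ (x (k + 1))).toReal := sub_nonneg.2 (hanti k.le_succ)
    have hk : (φ (x k)).toReal ≤ (φ (x 0)).toReal := hanti k.zero_le
    have hp0 : 0 ≤ p := (P.step_pos 0).le.trans (hp 0)
    rw [hx.1] at hk
    rw [mul_assoc]
    gcongr
    exact hp k

section Limit

variable {x₀ : X} {ι : Type*} {L : Filter ι} {P Q : ι → TimePartition} {x y : ι → ℕ → X} {τ t : ℝ}

theorem tendsto_mesh_mul_energy_drop (hbot : ∀ x, φ x ≠ ⊥) (hτ : 0 < τ) (hx₀ : φ x₀ ≠ ⊤)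
    (hτb : moreauYosida φ τ x₀ ≠ ⊥) (hx : ∀ i, IsDiscreteSolution φ (P i) x₀ (x i))
    (hP : Tendsto (fun i => (P i).mesh) L (𝓝 0)) (ht : 0 ≤ t) :
    Tendsto (fun i => (P i).mesh.toReal *
      ((φ x₀).toReal - (φ (interp (P i) (x i) t)).toReal)) L (𝓝 0) := by
  obtain ⟨H, δ, hδ, hH⟩ := exists_energy_drop_le hbot hτ hx₀ hτb t
  have hlim : Tendsto (fun i => (P i).mesh.toReal * H) L (𝓝 0) := by
    simpa using ((ENNReal.tendsto_toReal ENNReal.zero_ne_top).comp hP).mul_const H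
  refine squeeze_zero' (Eventually.of_forall fun i => mul_nonneg ENNReal.toReal_nonneg
    ((hx i).energy_drop_nonneg hbot hx₀ t)) ?_ hlim
  filter_upwards [hP.eventually_lt_const (ENNReal.ofReal_pos.2 hδ)] with i hi
  exact mul_le_mul_of_nonneg_left (hH _ _ (hx i) hi t (right_mem_Icc.2 ht)) ENNReal.toReal_nonneg

theorem tendsto_dist_index_pred (hbot : ∀ x, φ x ≠ ⊥) (hτ : 0 < τ) (hx₀ : φ x₀ ≠ ⊤)
    (hτb : moreauYosida φ τ x₀ ≠ ⊥) (hx : ∀ i, IsDiscreteSolution φ (P i) x₀ (x i))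
    (hP : Tendsto (fun i => (P i).mesh) L (𝓝 0)) (ht : 0 ≤ t) :
    Tendsto (fun i => dist (x i ((P i).index t - 1)) (x i ((P i).index t))) L (𝓝 0) := by
  have hlim := ((tendsto_mesh_mul_energy_drop hbot hτ hx₀ hτb hx hP ht).const_mul 2).sqrt
  rw [mul_zero, Real.sqrt_zero] at hlim
  refine squeeze_zero' (Eventually.of_forall fun i => dist_nonneg) ?_ hlim
  filter_upwards [hP.eventually_lt_const ENNReal.zero_lt_top] with i hi
  exact (hx i).dist_index_pred_le hbot hx₀ ((P i).step_le_mesh hi.ne) t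

variable {μ κ : ℝ}

theorem tendsto_errorConst_mul_sqrt (hbot : ∀ x, φ x ≠ ⊥) (hτ : 0 < τ) (hx₀ : φ x₀ ≠ ⊤)
    (hτb : moreauYosida φ τ x₀ ≠ ⊥) (hx : ∀ i, IsDiscreteSolution φ (P i) x₀ (x i))
    (hP : Tendsto (fun i => (P i).mesh) L (𝓝 0)) (ht : 0 ≤ t) :
    Tendsto (fun i => errorConst μ κ (P i).mesh.toReal * √((P i).mesh.toReal *
      ((φ x₀).toReal - (φ (interp (P i) (x i) t)).toReal))) L (𝓝 0) := by
  have hcont : Continuous (errorConst μ κ) := by unfold errorConst; fun_prop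
  have hmesh := (ENNReal.tendsto_toReal ENNReal.zero_ne_top).comp hP
  have hlim := ((hcont.tendsto _).comp hmesh).mul
    (tendsto_mesh_mul_energy_drop hbot hτ hx₀ hτb hx hP ht).sqrt
  rwa [Real.sqrt_zero, mul_zero] at hlim

theorem tendsto_dist_interp (hbot : ∀ x, φ x ≠ ⊥) (hμ : 0 ≤ μ) (hκ : 0 ≤ κ)
    (hevi : DiscreteEVI φ μ κ) (hτ : 0 < τ) (hx₀ : φ x₀ ≠ ⊤) (hτb : moreauYosida φ τ x₀ ≠ ⊥)
    (hx : ∀ i, IsDiscreteSolution φ (P i) x₀ (x i)) (hP : Tendsto (fun i => (P i).mesh) L (𝓝 0))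
    (hy : ∀ i, IsDiscreteSolution φ (Q i) x₀ (y i)) (hQ : Tendsto (fun i => (Q i).mesh) L (𝓝 0))
    (ht : 0 ≤ t) :
    Tendsto (fun i => dist (interp (P i) (x i) t) (interp (Q i) (y i) t)) L (𝓝 0) := by
  have hlim := (((tendsto_errorConst_mul_sqrt (μ := μ) (κ := κ) hbot hτ hx₀ hτb hx hP ht).add
    (tendsto_errorConst_mul_sqrt (μ := μ) (κ := κ) hbot hτ hx₀ hτb hy hQ ht)).const_mul
      (Real.exp (μ * t))).add ((tendsto_dist_index_pred hbot hτ hx₀ hτb hx hP ht).add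
        (tendsto_dist_index_pred hbot hτ hx₀ hτb hy hQ ht))
  rw [add_zero, mul_zero, add_zero] at hlim
  refine squeeze_zero' (Eventually.of_forall fun i => dist_nonneg) ?_ hlim
  filter_upwards [hP.eventually_lt_const ENNReal.zero_lt_top,
    hQ.eventually_lt_const ENNReal.zero_lt_top] with i hPi hQi
  exact (dist_interp_le_sqrt_sqDistInterp_add _ _ _ _ ht).trans (add_le_add_left
    (sqrt_sqDistInterp_le hbot hμ hκ hevi hx₀ (hx i) (hy i) ((P i).step_le_mesh hPi.ne)
      ((Q i).step_le_mesh hQi.ne) ht) _)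

theorem tendsto_interpolate_sq_dist (hbot : ∀ x, φ x ≠ ⊥) (hτ : 0 < τ) (hx₀ : φ x₀ ≠ ⊤)
    (hτb : moreauYosida φ τ x₀ ≠ ⊥) (hx : ∀ i, IsDiscreteSolution φ (P i) x₀ (x i))
    (hP : Tendsto (fun i => (P i).mesh) L (𝓝 0)) (ht : 0 ≤ t) {z : X}
    (hz : Tendsto (fun i => interp (P i) (x i) t) L (𝓝 z)) (a : X) :
    Tendsto (fun i => (P i).interpolate 1 (fun k => dist a (x i k) ^ 2) t) L
      (𝓝 (dist a z ^ 2)) := by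
  have hpred : Tendsto (fun i => x i ((P i).index t - 1)) L (𝓝 z) :=
    hz.congr_dist ((tendsto_dist_index_pred hbot hτ hx₀ hτb hx hP ht).congr fun _ => dist_comm _ _)
  have h₀ := (tendsto_const_nhds (x := a).dist hpred).pow 2
  have h₁ := (tendsto_const_nhds (x := a).dist hz).pow 2
  have hmin := h₀.min h₁
  have hmax := h₀.max h₁
  rw [min_self] at hmin
  rw [max_self] at hmax
  exact tendsto_of_tendsto_of_tendsto_of_le_of_le hmin hmax
    (fun i => ((P i).interpolate_mem_uIcc 1 (fun k => dist a (x i k) ^ 2) ht).1)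
    (fun i => ((P i).interpolate_mem_uIcc 1 (fun k => dist a (x i k) ^ 2) ht).2)

end Limit

section GradientCurve

variable {x₀ : X} {ξ ζ : ℝ → X} {μ κ τ t : ℝ}

/-- Pass to the limit in the second solution of the comparison estimate. -/
theorem IsGradientCurve.interpDist_le (hξ : IsGradientCurve φ x₀ ξ) (hbot : ∀ x, φ x ≠ ⊥)
    (hμ : 0 ≤ μ) (hκ : 0 ≤ κ) (hevi : DiscreteEVI φ μ κ) (hτ : 0 < τ) (hx₀ : φ x₀ ≠ ⊤)
    (hτb : moreauYosida φ τ x₀ ≠ ⊥) {P : TimePartition} {x : ℕ → X}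
    (hx : IsDiscreteSolution φ P x₀ x) {p : ℝ} (hp : ∀ k, P.pt (k + 1) - P.pt k ≤ p)
    (ht : 0 ≤ t) :
    interpDist P x t (ξ t) ≤ Real.exp (μ * t) *
      (errorConst μ κ p * √(p * ((φ x₀).toReal - (φ (interp P x t)).toReal))) := by
  obtain ⟨Q, y, hy, hQ, hlim⟩ := hξ
  have hleft : Tendsto (fun i => √(sqDistInterp P (Q i) x (y i) t)) atTop
      (𝓝 (interpDist P x t (ξ t))) := by
    rw [interpDist_eq_sqrt_interpolate]
    exact (P.tendsto_interpolate 1 (fun k =>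
      tendsto_interpolate_sq_dist hbot hτ hx₀ hτb hy hQ ht (hlim t ht) (x k)) t).sqrt
  have hright := ((tendsto_errorConst_mul_sqrt (μ := μ) (κ := κ) hbot hτ hx₀ hτb hy hQ
    ht).const_add (errorConst μ κ p * √(p * ((φ x₀).toReal - (φ (interp P x t)).toReal)))).const_mul
      (Real.exp (μ * t))
  rw [add_zero] at hright
  refine le_of_tendsto_of_tendsto hleft hright ?_
  filter_upwards [hQ.eventually_lt_const ENNReal.zero_lt_top] with i hi
  exact sqrt_sqDistInterp_le hbot hμ hκ hevi hx₀ hx (hy i) hp ((Q i).step_le_mesh hi.ne) ht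

theorem IsGradientCurve.eq_of_nonneg (hξ : IsGradientCurve φ x₀ ξ) (hζ : IsGradientCurve φ x₀ ζ)
    (hbot : ∀ x, φ x ≠ ⊥) (hμ : 0 ≤ μ) (hκ : 0 ≤ κ) (hevi : DiscreteEVI φ μ κ) (hτ : 0 < τ)
    (hx₀ : φ x₀ ≠ ⊤) (hτb : moreauYosida φ τ x₀ ≠ ⊥) (ht : 0 ≤ t) : ξ t = ζ t := by
  obtain ⟨P, x, hx, hP, hxlim⟩ := hξ
  obtain ⟨Q, y, hy, hQ, hylim⟩ := hζ
  exact dist_eq_zero.1 (tendsto_nhds_unique ((hxlim t ht).dist (hylim t ht))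
    (tendsto_dist_interp hbot hμ hκ hevi hτ hx₀ hτb hx hP hy hQ ht))

theorem IsGradientCurve.congr (hξ : IsGradientCurve φ x₀ ξ) (h : ∀ t, 0 ≤ t → ζ t = ξ t) :
    IsGradientCurve φ x₀ ζ := by
  obtain ⟨P, x, hx, hP, hlim⟩ := hξ
  exact ⟨P, x, hx, hP, fun t ht => (h t ht).symm ▸ hlim t ht⟩

theorem IsGradientCurve.interpDist_sq_le (hξ : IsGradientCurve φ x₀ ξ) (hbot : ∀ x, φ x ≠ ⊥)
    (hμ : 0 ≤ μ) (hκ : 0 ≤ κ) (hevi : DiscreteEVI φ μ κ) (hτ : 0 < τ) (hx₀ : φ x₀ ≠ ⊤)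
    (hτb : moreauYosida φ τ x₀ ≠ ⊥) {P : TimePartition} {x : ℕ → X}
    (hx : IsDiscreteSolution φ P x₀ x) (hP : P.mesh ≠ ⊤) (ht : 0 ≤ t) :
    interpDist P x t (ξ t) ^ 2 ≤ Real.exp (2 * μ * t) * errorConst μ κ P.mesh.toReal ^ 2 *
      P.mesh.toReal * ((φ x₀).toReal - (φ (interp P x t)).toReal) := by
  have hΔ := hx.energy_drop_nonneg hbot hx₀ t
  refine (pow_le_pow_left₀ (Real.sqrt_nonneg _) (hξ.interpDist_le hbot hμ hκ hevi hτ hx₀ hτb hx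
    (P.step_le_mesh hP) ht) 2).trans_eq ?_
  rw [mul_pow, mul_pow, Real.sq_sqrt (mul_nonneg ENNReal.toReal_nonneg hΔ), ← Real.exp_nat_mul,
    Nat.cast_two, mul_assoc 2 μ t]
  ring

theorem IsGradientCurve.exists_interpDist_le_mul_sqrt (hξ : IsGradientCurve φ x₀ ξ)
    (hbot : ∀ x, φ x ≠ ⊥) (hμ : 0 ≤ μ) (hκ : 0 ≤ κ) (hevi : DiscreteEVI φ μ κ) (hτ : 0 < τ)
    (hx₀ : φ x₀ ≠ ⊤) (hτb : moreauYosida φ τ x₀ ≠ ⊥) (T : ℝ) :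
    ∃ C δ : ℝ, 0 < δ ∧ ∀ (P : TimePartition) (x : ℕ → X), P.mesh < ENNReal.ofReal δ →
      IsDiscreteSolution φ P x₀ x → ∀ t ∈ Icc 0 T,
        interpDist P x t (ξ t) ≤ C * √P.mesh.toReal := by
  obtain ⟨H, δ, hδ, hH⟩ := exists_energy_drop_le hbot hτ hx₀ hτb T
  refine ⟨Real.exp (μ * T) * (errorConst μ κ δ * √H), δ, hδ, fun P x hP hx t ht => ?_⟩
  have hmesh : P.mesh.toReal ≤ δ := (ENNReal.toReal_lt_of_lt_ofReal hP).le
  calc interpDist P x t (ξ t)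
      ≤ Real.exp (μ * t) * (errorConst μ κ P.mesh.toReal *
          √(P.mesh.toReal * ((φ x₀).toReal - (φ (interp P x t)).toReal))) :=
        hξ.interpDist_le hbot hμ hκ hevi hτ hx₀ hτb hx (P.step_le_mesh hP.ne_top) ht.1
    _ ≤ Real.exp (μ * T) * (errorConst μ κ δ * √(P.mesh.toReal * H)) := by
        gcongr
        · exact mul_nonneg (errorConst_nonneg _ _ _) (Real.sqrt_nonneg _)
        · exact ht.2
        · exact errorConst_nonneg _ _ _
        · exact errorConst_mono hμ hmesh
        · exact hH P x hx hP t ht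
    _ = Real.exp (μ * T) * (errorConst μ κ δ * √H) * √P.mesh.toReal := by
        rw [Real.sqrt_mul ENNReal.toReal_nonneg]
        ring

theorem isGradientCurve_gradientFlow (h : ∃ ξ : ℝ → X, IsGradientCurve φ x₀ ξ) :
    IsGradientCurve φ x₀ fun t => gradientFlow φ t x₀ := by
  simpa only [gradientFlow, dif_pos h] using h.choose_spec

/-- The partition `0 < h < 2h < ⋯` with constant step `h`. -/
def uniformPartition (h : ℝ) (hh : 0 < h) : TimePartition where
  pt k := k * h
  pt_zero := by rw [Nat.cast_zero, zero_mul]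
  strictMono := Nat.strictMono_cast.mul_const hh
  tendsto_atTop := tendsto_natCast_atTop_atTop.atTop_mul_const hh

theorem uniformPartition_step {h : ℝ} (hh : 0 < h) (k : ℕ) :
    (uniformPartition h hh).pt (k + 1) - (uniformPartition h hh).pt k = h := by
  simp only [uniformPartition, Nat.cast_add_one]
  ring

theorem uniformPartition_mesh {h : ℝ} (hh : 0 < h) :
    (uniformPartition h hh).mesh = ENNReal.ofReal h := by
  simp only [TimePartition.mesh, uniformPartition_step, ciSup_const]

theorem exists_isDiscreteSolution_uniformPartition {h : ℝ} (hh : 0 < h)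
    (hres : ∀ x, (resolvent φ h x).Nonempty) (x₀ : X) :
    ∃ x, IsDiscreteSolution φ (uniformPartition h hh) x₀ x := by
  choose J hJ using hres
  refine ⟨fun k => J^[k] x₀, rfl, fun k => ?_⟩
  simp only [uniformPartition_step, Function.iterate_succ_apply']
  exact hJ _

theorem exists_isGradientCurve [CompleteSpace X] (hbot : ∀ x, φ x ≠ ⊥) (hμ : 0 ≤ μ) (hκ : 0 ≤ κ)
    (hevi : DiscreteEVI φ μ κ) (hx₀ : φ x₀ ≠ ⊤) {τs : ℝ≥0∞} (hcoer : Coercive φ τs)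
    (hτ : 0 < τ) (hτs : ENNReal.ofReal τ < τs) : ∃ ξ, IsGradientCurve φ x₀ ξ := by
  have hpos : ∀ i : ℕ, 0 < τ / (i + 1 : ℝ) := fun i => by positivity
  have hle : ∀ i : ℕ, τ / (i + 1 : ℝ) ≤ τ := fun i => div_le_self hτ.le (by simp)
  choose x hx using fun i => exists_isDiscreteSolution_uniformPartition (hpos i) (fun z =>
    (hcoer.2 z _ (hpos i) ((ENNReal.ofReal_le_ofReal (hle i)).trans_lt hτs)).2) x₀
  have hmesh : Tendsto (fun i : ℕ => (uniformPartition _ (hpos i)).mesh) atTop (𝓝 0) := by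
    simp only [uniformPartition_mesh]
    rw [← ENNReal.ofReal_zero]
    refine ENNReal.tendsto_ofReal ?_
    simpa only [mul_one_div, mul_zero] using
      (tendsto_one_div_add_atTop_nhds_zero_nat (𝕜 := ℝ)).const_mul τ
  have hcauchy : ∀ t, 0 ≤ t → CauchySeq fun i => interp (uniformPartition _ (hpos i)) (x i) t := by
    intro t ht
    rw [cauchySeq_iff_tendsto_dist_atTop_0, ← prod_atTop_atTop_eq]
    exact tendsto_dist_interp hbot hμ hκ hevi hτ hx₀ (hcoer.2 x₀ τ hτ hτs).1
      (fun i => hx i.1) (hmesh.comp tendsto_fst) (fun i => hx i.2) (hmesh.comp tendsto_snd) ht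
  have : Nonempty X := ⟨x₀⟩
  choose! ξ hξ using fun t ht => cauchySeq_tendsto_of_complete (hcauchy t ht)
  exact ⟨ξ, _, x, hx, hmesh, hξ⟩

end GradientCurve

end DiscreteSolution

/-! ### Spherical trigonometry -/

theorem mul_sin_le_mul_sin {a c : ℝ} (ha : 0 ≤ a) (hac : a ≤ c) (hc : c ≤ Real.pi) :
    a * Real.sin c ≤ c * Real.sin a := by
  rcases (ha.trans hac).eq_or_lt with rfl | hc0
  · rw [le_antisymm hac ha]
  have h := strictConcaveOn_sin_Icc.concaveOn.2 (left_mem_Icc.2 Real.pi_pos.le)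
    (show c ∈ Icc 0 Real.pi from ⟨hc0.le, hc⟩) (sub_nonneg.2 ((div_le_one hc0).2 hac))
    (div_nonneg ha hc0.le) (sub_add_cancel _ _)
  simp only [smul_eq_mul, mul_zero, Real.sin_zero, zero_add, div_mul_cancel₀ _ hc0.ne'] at h
  rwa [div_mul_eq_mul_div, div_le_iff₀ hc0, mul_comm (Real.sin a)] at h

/-- On `[0, π]`, `u²` is a convex function of `-cos u`; this is its tangent line at `u = c`. -/
theorem mul_cos_sub_cos_le {a c : ℝ} (ha : 0 ≤ a) (haπ : a ≤ Real.pi) (hc : 0 < c)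
    (hcπ : c < Real.pi) :
    2 * (c / Real.sin c) * (Real.cos c - Real.cos a) ≤ a ^ 2 - c ^ 2 := by
  have hs := Real.sin_pos_of_pos_of_lt_pi hc hcπ
  let h : ℝ → ℝ := fun u => u ^ 2 + 2 * (c / Real.sin c) * Real.cos u
  have hderiv : ∀ u, HasDerivAt h (2 * (u - c / Real.sin c * Real.sin u)) u := fun u =>
    ((hasDerivAt_pow 2 u).add ((Real.hasDerivAt_cos u).const_mul _)).congr_deriv (by
      push_cast
      ring)
  suffices h c ≤ h a by simp only [h] at this; linarith
  rcases le_total a c with hac | hca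
  · refine antitoneOn_of_hasDerivWithinAt_nonpos (convex_Icc a c)
      (fun u _ => (hderiv u).continuousAt.continuousWithinAt)
      (fun u _ => (hderiv u).hasDerivWithinAt) (fun u hu => ?_)
      (left_mem_Icc.2 hac) (right_mem_Icc.2 hac) hac
    rw [interior_Icc] at hu
    have hu' : u ≤ c / Real.sin c * Real.sin u := by
      rw [div_mul_eq_mul_div, le_div_iff₀ hs]
      exact mul_sin_le_mul_sin (ha.trans hu.1.le) hu.2.le hcπ.le
    linarith
  · refine monotoneOn_of_hasDerivWithinAt_nonneg (convex_Icc c a)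
      (fun u _ => (hderiv u).continuousAt.continuousWithinAt)
      (fun u _ => (hderiv u).hasDerivWithinAt) (fun u hu => ?_)
      (left_mem_Icc.2 hca) (right_mem_Icc.2 hca) hca
    rw [interior_Icc] at hu
    have hu' : c / Real.sin c * Real.sin u ≤ u := by
      rw [div_mul_eq_mul_div, div_le_iff₀ hs]
      exact mul_sin_le_mul_sin hc.le hu.1.le (hu.2.le.trans haπ)
    linarith

/-- The cosine of an angle of a spherical triangle, with `a` the length of the opposite side and
`b`, `c` those of the adjacent ones; the value is `0` if `b` or `c` vanishes. -/
def sphericalCos (a b c : ℝ) : ℝ :=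
  (Real.cos a - Real.cos b * Real.cos c) / (Real.sin b * Real.sin c)

theorem spherical_law_of_cosines {a b c : ℝ} (hb : Real.sin b ≠ 0) (hc : Real.sin c ≠ 0) :
    Real.cos b * Real.cos c + Real.sin b * Real.sin c * sphericalCos a b c = Real.cos a := by
  rw [sphericalCos, mul_div_cancel₀ _ (mul_ne_zero hb hc), add_sub_cancel]

theorem sphericalCos_mem_Icc {a b c : ℝ} (hb : 0 < b) (hc : 0 < c) (ha_le : a ≤ b + c)
    (hb_le : b ≤ a + c) (hc_le : c ≤ a + b) (hperim : a + b + c < 2 * Real.pi) :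
    sphericalCos a b c ∈ Icc (-1 : ℝ) 1 := by
  have hsb := Real.sin_pos_of_pos_of_lt_pi hb (by linarith)
  have hsc := Real.sin_pos_of_pos_of_lt_pi hc (by linarith)
  have hsub : Real.cos a ≤ Real.cos (b - c) := by
    rw [← Real.cos_abs (b - c)]
    exact Real.cos_le_cos_of_nonneg_of_le_pi (abs_nonneg _) (by linarith)
      (abs_le.2 ⟨by linarith, by linarith⟩)
  have hadd : Real.cos (b + c) ≤ Real.cos a := by
    rcases le_total (b + c) Real.pi with h | h
    · exact Real.cos_le_cos_of_nonneg_of_le_pi (by linarith) h ha_le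
    · rw [← Real.cos_two_pi_sub]
      exact Real.cos_le_cos_of_nonneg_of_le_pi (by linarith) (by linarith) (by linarith)
  rw [Real.cos_sub] at hsub
  rw [Real.cos_add] at hadd
  rw [sphericalCos, mem_Icc, le_div_iff₀ (mul_pos hsb hsc), div_le_one (mul_pos hsb hsc)]
  constructor <;> linarith

theorem mul_cos_le_sin {b : ℝ} (hb : 0 ≤ b) (hb' : b < Real.pi / 2) :
    b * Real.cos b ≤ Real.sin b := by
  have hcos : 0 < Real.cos b := Real.cos_pos_of_mem_Ioo ⟨by linarith, hb'⟩
  rw [← le_div_iff₀ hcos, ← Real.tan_eq_sin_div_cos]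
  exact Real.le_tan hb hb'

theorem neg_mul_sphericalCos_le {a b c : ℝ} (ha : 0 ≤ a) (ha' : a ≤ Real.pi / 2) (hb : 0 < b)
    (hb' : b < Real.pi / 2) (hc : 0 < c) (hc' : c < Real.pi / 2) :
    -(2 * b * c * sphericalCos a b c) ≤ a ^ 2 - c ^ 2 := by
  have hsb := Real.sin_pos_of_pos_of_lt_pi hb (by linarith)
  have hsc := Real.sin_pos_of_pos_of_lt_pi hc (by linarith)
  have hca : 0 ≤ Real.cos a := Real.cos_nonneg_of_neg_pi_div_two_le_of_le (by linarith) ha'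
  have hcc : 0 ≤ Real.cos c := Real.cos_nonneg_of_neg_pi_div_two_le_of_le (by linarith) hc'.le
  have hcos : Real.cos a - Real.cos c ≤
      b / Real.sin b * (Real.cos a - Real.cos b * Real.cos c) := by
    rw [div_mul_eq_mul_div, le_div_iff₀ hsb]
    nlinarith [mul_nonneg hca (sub_nonneg.2 (Real.sin_le hb.le)),
      mul_nonneg hcc (sub_nonneg.2 (mul_cos_le_sin hb.le hb'))]
  calc -(2 * b * c * sphericalCos a b c)
      = -(2 * (c / Real.sin c) *
          (b / Real.sin b * (Real.cos a - Real.cos b * Real.cos c))) := by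
        rw [sphericalCos]
        field_simp
    _ ≤ -(2 * (c / Real.sin c) * (Real.cos a - Real.cos c)) := by gcongr
    _ = 2 * (c / Real.sin c) * (Real.cos c - Real.cos a) := by ring
    _ ≤ a ^ 2 - c ^ 2 := mul_cos_sub_cos_le ha (by linarith) hc (by linarith)

/-- The point of `𝕊²` with polar coordinates `(r, θ)` around the first basis vector. -/
def spherePoint (r θ : ℝ) : Sphere2 :=
  ⟨!₂[Real.cos r, Real.sin r * Real.cos θ, Real.sin r * Real.sin θ], by
    rw [mem_sphere_zero_iff_norm, EuclideanSpace.norm_eq, Real.sqrt_eq_one]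
    simp only [Real.norm_eq_abs, sq_abs, Fin.sum_univ_three, Matrix.cons_val]
    linear_combination Real.sin_sq_add_cos_sq r + Real.sin r ^ 2 * Real.sin_sq_add_cos_sq θ⟩

theorem sphereDist_spherePoint (r θ r' θ' : ℝ) :
    sphereDist (spherePoint r θ) (spherePoint r' θ') = Real.arccos
      (Real.cos r * Real.cos r' + Real.sin r * Real.sin r' * Real.cos (θ - θ')) := by
  rw [sphereDist, InnerProductGeometry.angle, norm_eq_of_mem_sphere, norm_eq_of_mem_sphere,
    Real.cos_sub]
  congr 1
  simp only [spherePoint, PiLp.inner_apply, Fin.sum_univ_three, Matrix.cons_val,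
    RCLike.inner_apply, conj_trivial]
  ring

theorem sphereDist_spherePoint_of_le {r r' : ℝ} (θ : ℝ) (hle : r ≤ r')
    (hπ : r' - r ≤ Real.pi) :
    sphereDist (spherePoint r θ) (spherePoint r' θ) = r' - r := by
  rw [sphereDist_spherePoint, sub_self, Real.cos_zero, mul_one, ← Real.cos_sub, ← neg_sub,
    Real.cos_neg, Real.arccos_cos (sub_nonneg.2 hle) hπ]

theorem sphereDist_spherePoint_pole {r : ℝ} (θ θ' : ℝ) (hr : 0 ≤ r) (hπ : r ≤ Real.pi) :
    sphereDist (spherePoint r θ) (spherePoint 0 θ') = r := by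
  rw [sphereDist_spherePoint, Real.cos_zero, Real.sin_zero, mul_zero, zero_mul, mul_one, add_zero,
    Real.arccos_cos hr hπ]

theorem sphereDist_comm (p q : Sphere2) : sphereDist p q = sphereDist q p :=
  InnerProductGeometry.angle_comm _ _

theorem tendsto_slope_sq_arccos {b : ℝ} (hb : 0 < b) (hbπ : b < Real.pi) (c C : ℝ) :
    Tendsto (fun s => (Real.arccos (Real.cos b * Real.cos (s * c)
      + Real.sin b * Real.sin (s * c) * C) ^ 2 - b ^ 2) / s) (𝓝[>] 0) (𝓝 (-(2 * b * c * C))) := by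
  set g : ℝ → ℝ := fun s => Real.cos b * Real.cos (s * c) + Real.sin b * Real.sin (s * c) * C
  have hsin : 0 < Real.sin b := Real.sin_pos_of_pos_of_lt_pi hb hbπ
  have hg0 : g 0 = Real.cos b := by simp [g]
  have hacos : Real.arccos (g 0) = b := by rw [hg0, Real.arccos_cos hb.le hbπ.le]
  have hg : HasDerivAt g (Real.sin b * c * C) 0 := by
    have hlin := (hasDerivAt_id (0 : ℝ)).mul_const c
    refine ((hlin.cos.const_mul (Real.cos b)).add
      ((hlin.sin.const_mul (Real.sin b)).mul_const C)).congr_deriv ?_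
    simp
  have harccos : HasDerivAt Real.arccos (-(1 / Real.sin b)) (g 0) := by
    have hsq := Real.sin_sq_add_cos_sq b
    refine (Real.hasDerivAt_arccos ?_ ?_).congr_deriv ?_
    · rw [hg0]; nlinarith
    · rw [hg0]; nlinarith
    · rw [hg0, ← Real.sin_sq, Real.sqrt_sq hsin.le]
  have hderiv : HasDerivAt (fun s => Real.arccos (g s) ^ 2) (-(2 * b * c * C)) 0 := by
    refine ((harccos.comp 0 hg).pow 2).congr_deriv ?_
    simp only [Function.comp, hacos]
    field_simp
    push_cast
    ring
  refine ((hasDerivWithinAt_iff_tendsto_slope' self_notMem_Ioi).1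
    hderiv.hasDerivWithinAt).congr fun s => ?_
  rw [slope_def_field, hacos, sub_zero]

/-! ### The discrete evolution variational inequality -/

section DiscreteEVI

variable {X : Type*} [MetricSpace X] {φ : X → EReal}

/-- First order optimality of `z ∈ J_τ(x)` along a geodesic `γ` issuing from `z`; `L` is the slope
at `z` of an upper bound for `d²(x, γ(s))`. -/
theorem le_slope_of_mem_resolvent (hbot : ∀ x, φ x ≠ ⊥) {τ l : ℝ} (hτ : 0 < τ) {x z : X}
    (hx : φ x ≠ ⊤) (hz : z ∈ resolvent φ τ x) {γ : ℝ → X} (hγ : γ 0 = z)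
    (hφ : ConvexAlong φ l γ) {U : ℝ → ℝ} {L : ℝ}
    (hU : ∀ s ∈ Ioo (0 : ℝ) 1, dist x (γ s) ^ 2 ≤ U s)
    (hL : Tendsto (fun s : ℝ => (U s - dist x z ^ 2) / s) (𝓝[>] 0) (𝓝 L)) :
    2 * τ * ((φ z).toReal - (φ (γ 1)).toReal) + l * τ * dist z (γ 1) ^ 2 ≤ L := by
  have hlim : Tendsto (fun s : ℝ => 2 * τ * ((φ z).toReal - (φ (γ 1)).toReal)
      + l * τ * (1 - s) * dist z (γ 1) ^ 2) (𝓝[>] 0)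
      (𝓝 (2 * τ * ((φ z).toReal - (φ (γ 1)).toReal) + l * τ * (1 - 0) * dist z (γ 1) ^ 2)) :=
    (Continuous.tendsto (by fun_prop) 0).mono_left nhdsWithin_le_nhds
  rw [sub_zero, mul_one] at hlim
  refine le_of_tendsto_of_tendsto hlim hL ?_
  filter_upwards [Ioo_mem_nhdsGT (zero_lt_one' ℝ)] with s hs
  have hmin := add_le_of_mem_resolvent hbot hx hz (hφ s (Ioo_subset_Icc_self hs))
  rw [hγ, ← sub_nonneg] at hmin
  have hscaled := mul_nonneg (show 0 ≤ 2 * τ by positivity) hmin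
  field_simp at hscaled
  rw [le_div_iff₀ hs.1]
  linarith [hU s hs]

theorem discreteEVI_of_hasCommutingGeodesics (hbot : ∀ x, φ x ≠ ⊥) {l K : ℝ}
    (h : HasCommutingGeodesics φ l K) : DiscreteEVI φ (-l) (-K) := by
  obtain ⟨Γ, _, hjoin, hcomm, hK, hconv⟩ := h
  intro τ x z y hτ hx hy hz
  have hzt := ne_top_of_mem_resolvent hx hz
  obtain ⟨γ, hγ, rfl, rfl⟩ := hjoin z y hzt hy
  obtain ⟨η, hη, hη0, rfl⟩ := hjoin (γ 0) x hzt hx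
  obtain ⟨L, hγL, hηL⟩ := hcomm γ hγ η hη hη0.symm
  have hopt := le_slope_of_mem_resolvent hbot hτ hx hz rfl (hconv γ hγ hzt hy)
    (U := fun s => dist (γ s) (η 1) ^ 2) (fun s _ => by rw [dist_comm]) (by
      simpa only [dist_comm (η 1)] using hγL)
  have hlim : Tendsto (fun t : ℝ => dist (γ 1) (η 1) ^ 2 - dist (γ 1) (η 0) ^ 2
      - K / 2 * (1 - t) * dist (η 0) (η 1) ^ 2) (𝓝[>] 0) (𝓝 (dist (γ 1) (η 1) ^ 2
      - dist (γ 1) (η 0) ^ 2 - K / 2 * (1 - 0) * dist (η 0) (η 1) ^ 2)) :=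
    (Continuous.tendsto (by fun_prop) 0).mono_left nhdsWithin_le_nhds
  have hslope := le_of_tendsto_of_tendsto hηL hlim (by
    filter_upwards [Ioo_mem_nhdsGT (zero_lt_one' ℝ)] with t ht
    rw [div_le_iff₀ ht.1, dist_comm (η t), dist_comm (η 0) (γ 1)]
    linarith [hK η hη (γ 1) t (Ioo_subset_Icc_self ht)])
  rw [hη0, dist_comm (γ 1), dist_comm (γ 1), dist_comm (γ 0) (η 1)] at hslope
  linarith

theorem IsCAT1.dist_le_arccos (h : IsCAT1 X) {x z y : X}
    (hperim : dist x z + dist z y + dist y x < 2 * Real.pi) (hxz : 0 < dist x z)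
    (hzy : 0 < dist z y) {γ : ℝ → X} (hγ : IsMinGeodesic γ z y) {t : ℝ}
    (ht : t ∈ Icc (0 : ℝ) 1) :
    dist x (γ t) ≤ Real.arccos (Real.cos (dist x z) * Real.cos (t * dist z y)
      + Real.sin (dist x z) * Real.sin (t * dist z y) *
        sphericalCos (dist x y) (dist x z) (dist z y)) := by
  have hxy_le := dist_triangle x z y
  have hxz_le := dist_triangle_right x z y
  have hzy_le := add_comm (dist x z) _ ▸ dist_triangle_left z y x
  rw [dist_comm y x] at hperim
  have hmem := sphericalCos_mem_Icc hxz hzy hxy_le hxz_le hzy_le (by linarith)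
  have hcosθ := Real.cos_arccos hmem.1 hmem.2
  set θ := Real.arccos (sphericalCos (dist x y) (dist x z) (dist z y))
  have hlaw := spherical_law_of_cosines (a := dist x y)
    (Real.sin_pos_of_pos_of_lt_pi hxz (by linarith)).ne'
    (Real.sin_pos_of_pos_of_lt_pi hzy (by linarith)).ne'
  have ht0 : 0 ≤ t * dist z y := mul_nonneg ht.1 hzy.le
  have ht1 : t * dist z y ≤ dist z y := mul_le_of_le_one_left hzy.le ht.2
  rw [← hcosθ, ← sub_zero θ] at hlaw ⊢
  rw [← sphereDist_spherePoint]
  refine h.2 x z y (by rwa [dist_comm y x]) γ hγ (spherePoint (dist x z) θ) (spherePoint 0 0)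
    (spherePoint (dist z y) 0) ?_ ?_ ?_ t ht (spherePoint (t * dist z y) 0) ?_ ?_
  · exact sphereDist_spherePoint_pole _ _ hxz.le (by linarith)
  · rw [sphereDist_spherePoint_of_le 0 hzy.le (by linarith), sub_zero]
  · rw [sphereDist_comm, sphereDist_spherePoint, hlaw,
      Real.arccos_cos dist_nonneg (by linarith), dist_comm]
  · rw [sphereDist_spherePoint_of_le 0 ht0 (by linarith), sub_zero]
  · rw [sphereDist_spherePoint_of_le 0 ht1 (by linarith)]
    ring

theorem energy_le_of_mem_resolvent_self (hbot : ∀ x, φ x ≠ ⊥) {τ l : ℝ} (hτ : 0 < τ) {x y : X}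
    (hx : φ x ≠ ⊤) (hxx : x ∈ resolvent φ τ x) {γ : ℝ → X} (hγ : IsMinGeodesic γ x y)
    (hφ : ConvexAlong φ l γ) :
    2 * τ * ((φ x).toReal - (φ y).toReal) + l * τ * dist x y ^ 2 ≤ 0 := by
  obtain ⟨hγ0, rfl, hγd⟩ := hγ
  have hlim : Tendsto (fun s : ℝ => s * dist x (γ 1) ^ 2) (𝓝[>] 0) (𝓝 (0 * dist x (γ 1) ^ 2)) :=
    (Continuous.tendsto (by fun_prop) 0).mono_left nhdsWithin_le_nhds
  rw [zero_mul] at hlim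
  refine le_slope_of_mem_resolvent hbot hτ hx hxx hγ0 hφ (U := fun s => (s * dist x (γ 1)) ^ 2)
    (fun s hs => ?_) (hlim.congr' ?_)
  · have hs' := hγd 0 (left_mem_Icc.2 zero_le_one) s (Ioo_subset_Icc_self hs)
    rw [hγ0, zero_sub, abs_neg, abs_of_pos hs.1] at hs'
    rw [hs']
  · filter_upwards [self_mem_nhdsWithin] with s (hs : 0 < s)
    rw [dist_self]
    field_simp
    ring

theorem discreteEVI_of_isCAT1 (hbot : ∀ x, φ x ≠ ⊥) {l : ℝ} (hconv : IsSemiConvex φ l)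
    (h : IsCAT1 X) (hd : ∀ x y : X, dist x y < Real.pi / 2) : DiscreteEVI φ (-l) 0 := by
  intro τ x z y hτ hx hy hz
  obtain ⟨γ, hγ, hφ⟩ := hconv z y (ne_top_of_mem_resolvent hx hz) hy
  rcases eq_or_ne z y with rfl | hzy
  · simp
  rcases eq_or_ne x z with rfl | hxz
  · linarith [energy_le_of_mem_resolvent_self hbot hτ hx hz hγ hφ, dist_self x]
  rw [← dist_pos] at hzy hxz
  have hperim : dist x z + dist z y + dist y x < 2 * Real.pi := by
    linarith [hd x z, hd z y, hd y x, Real.pi_pos]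
  have hopt := le_slope_of_mem_resolvent hbot hτ hx hz hγ.1 hφ
    (fun s hs => pow_le_pow_left₀ dist_nonneg
      (h.dist_le_arccos hperim hxz hzy hγ (Ioo_subset_Icc_self hs)) 2)
    (tendsto_slope_sq_arccos hxz (by linarith [hd x z, Real.pi_pos]) _ _)
  rw [hγ.2.1] at hopt
  linarith [neg_mul_sphericalCos_le dist_nonneg (hd x y).le hxz (hd x z) hzy (hd z y)]

theorem DiscreteEVI.mono {μ κ κ' : ℝ} (h : DiscreteEVI φ μ κ) (hκ : κ ≤ κ') :
    DiscreteEVI φ μ κ' := by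
  intro τ x z y hτ hx hy hz
  refine (h τ x z y hτ hx hy hz).trans ?_
  gcongr

theorem discreteEVI_of_isCAT1_or_hasCommutingGeodesics (hbot : ∀ x, φ x ≠ ⊥) {l K : ℝ}
    (hconv : IsSemiConvex φ l)
    (hcase : (IsCAT1 X ∧ Metric.ediam (univ : Set X) < ENNReal.ofReal (Real.pi / 2)) ∨
      HasCommutingGeodesics φ l K) : DiscreteEVI φ (-l) (-min 0 K) := by
  rcases hcase with ⟨hcat, hdiam⟩ | hcomm
  · refine (discreteEVI_of_isCAT1 hbot hconv hcat fun x y => ?_).mono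
      (neg_nonneg.2 (min_le_left _ _))
    rw [← edist_lt_ofReal]
    exact (Metric.edist_le_ediam_of_mem (mem_univ x) (mem_univ y)).trans_lt hdiam
  · exact (discreteEVI_of_hasCommutingGeodesics hbot hcomm).mono (neg_le_neg (min_le_right _ _))

end DiscreteEVI

end MetricGF

end

theorem corollary4p3_general {X : Type*} [MetricSpace X] [CompleteSpace X]
    (φ : X → EReal) (hbot : ∀ x, φ x ≠ ⊥) {μ κ : ℝ} (hμ : 0 ≤ μ) (hκ : 0 ≤ κ)
    (hevi : MetricGF.DiscreteEVI φ μ κ) {τs : ℝ≥0∞} (hcoer : MetricGF.Coercive φ τs)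
    {x₀ : X} (hx₀ : φ x₀ ≠ ⊤) :
    (∀ ξ : ℝ → X, MetricGF.IsGradientCurve φ x₀ ξ ↔
      ∀ t : ℝ, 0 ≤ t → ξ t = MetricGF.gradientFlow φ t x₀) ∧
    (∀ (P : MetricGF.TimePartition) (x : ℕ → X), P.mesh ≠ ⊤ →
      MetricGF.IsDiscreteSolution φ P x₀ x → ∀ t : ℝ, 0 < t →
        MetricGF.interpDist P x t (MetricGF.gradientFlow φ t x₀) ^ 2 ≤
          Real.exp (2 * μ * t) * MetricGF.errorConst μ κ P.mesh.toReal ^ 2 * P.mesh.toReal *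
            ((φ x₀).toReal - (φ (MetricGF.interp P x t)).toReal)) ∧
    (∀ T : ℝ, ∃ C δ : ℝ, 0 < δ ∧
      ∀ (P : MetricGF.TimePartition) (x : ℕ → X), P.mesh < ENNReal.ofReal δ →
        MetricGF.IsDiscreteSolution φ P x₀ x → ∀ t : ℝ, 0 < t → t ≤ T →
          MetricGF.interpDist P x t (MetricGF.gradientFlow φ t x₀) ≤
            C * Real.sqrt P.mesh.toReal) := by
  obtain ⟨τ, hτ, hτs⟩ : ∃ τ : ℝ, 0 < τ ∧ ENNReal.ofReal τ < τs := by
    obtain ⟨τ, hτ, hτs⟩ := ENNReal.lt_iff_exists_nnreal_btwn.1 hcoer.1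
    exact ⟨τ, NNReal.coe_pos.2 (ENNReal.coe_pos.1 hτ), by rwa [ENNReal.ofReal_coe_nnreal]⟩
  have hτb := (hcoer.2 x₀ τ hτ hτs).1
  have hflow := MetricGF.isGradientCurve_gradientFlow
    (MetricGF.exists_isGradientCurve hbot hμ hκ hevi hx₀ hcoer hτ hτs)
  refine ⟨fun ξ => ⟨fun hξ t ht => hξ.eq_of_nonneg hflow hbot hμ hκ hevi hτ hx₀ hτb ht,
    hflow.congr⟩, fun P x hP hx t ht =>
      hflow.interpDist_sq_le hbot hμ hκ hevi hτ hx₀ hτb hx hP ht.le, fun T => ?_⟩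
  obtain ⟨C, δ, hδ, hC⟩ := hflow.exists_interpDist_le_mul_sqrt hbot hμ hκ hevi hτ hx₀ hτb T
  exact ⟨C, δ, hδ, fun P x hP hx t ht htT => hC P x hP hx t ⟨ht.le, htT⟩⟩

theorem corollary4p3 {X : Type*} [MetricSpace X] [CompleteSpace X]
    (φ : X → EReal) (hbot : ∀ x, φ x ≠ ⊥) (hlsc : LowerSemicontinuous φ)
    (l K : ℝ) (hl : l ≤ 0) (hconv : MetricGF.IsSemiConvex φ l)
    (τs : ℝ≥0∞) (hcoer : MetricGF.Coercive φ τs)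
    (hcase : (MetricGF.IsCAT1 X ∧ Metric.ediam (Set.univ : Set X) < ENNReal.ofReal (Real.pi / 2)) ∨
      MetricGF.HasCommutingGeodesics φ l K)
    (x₀ : X) (hx₀ : φ x₀ ≠ ⊤) :
    -- the gradient curve from `x₀` exists, is unique, and is `t ↦ 𝒢(t, x₀)`
    (∀ ξ : ℝ → X, MetricGF.IsGradientCurve φ x₀ ξ ↔
      ∀ t : ℝ, 0 ≤ t → ξ t = MetricGF.gradientFlow φ t x₀) ∧
    -- the error estimate
    (∀ (P : MetricGF.TimePartition) (x : ℕ → X), P.mesh < τs →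
      MetricGF.IsDiscreteSolution φ P x₀ x → ∀ t : ℝ, 0 < t →
        MetricGF.interpDist P x t (MetricGF.gradientFlow φ t x₀) ^ 2 ≤
          Real.exp (-2 * l * t) *
            (Real.sqrt (1 - min 0 K - 2 * l / 3 * P.mesh.toReal) +
              Real.sqrt (-(4 * l / 3) * P.mesh.toReal)) ^ 2 *
            P.mesh.toReal * ((φ x₀).toReal - (φ (MetricGF.interp P x t)).toReal)) ∧
    -- the resulting rate on bounded time intervals
    (∀ T : ℝ, 0 < T → ∃ C δ : ℝ, 0 < δ ∧
      ∀ (P : MetricGF.TimePartition) (x : ℕ → X), P.mesh < ENNReal.ofReal δ →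
        MetricGF.IsDiscreteSolution φ P x₀ x → ∀ t : ℝ, 0 < t → t ≤ T →
          MetricGF.interpDist P x t (MetricGF.gradientFlow φ t x₀) ≤
            C * Real.sqrt P.mesh.toReal) := by
  obtain ⟨hflow, hest, hrate⟩ := corollary4p3_general φ hbot (neg_nonneg.2 hl)
    (neg_nonneg.2 (min_le_left 0 K))
    (MetricGF.discreteEVI_of_isCAT1_or_hasCommutingGeodesics hbot hconv hcase) hcoer hx₀
  exact ⟨hflow, fun P x hP => by
    simpa only [MetricGF.errorConst, mul_neg, neg_mul, neg_div, ← sub_eq_add_neg] using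
      hest P x hP.ne_top, fun T _ => hrate T⟩
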